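/- **Conventions.** A reduced alternating diagram of a prime link is regarded as a 4-regular plane graph (up to isotopy of the sphere) with over/under information that alternates along every strand, without nugatory crossings and 3-edge-connected (which expresses that the link is prime). A *subgroup* of a 4-regular plane graph is a sequence of $k\ge 1$ distinct vertices in which consecutive vertices are joined by the two sides of a 2-gon; $k$ is its size; a *group* is a subgroup whose vertex set is maximal. A subgroup has two ends, with two outgoing strands at each end, and its axis runs from one end to the other. *Collapsing* a decomposition of the vertex set into disjoint subgroups replaces each subgroup by one vertex which keeps its four outgoing strands in their cyclic order; collapsing all groups of $D$ gives the *condensation* of $D$. The operation $T$ turns a subgroup, viewed as a 4-tangle, by $90^\circ$ (switching its crossings so that the diagram stays alternating). An *$ots$-triangle* is a triangular face with three distinct vertices, no two of which are joined by a second edge. If the six other edges at its vertices are, in clockwise order, $1,\dots,6$, attached in pairs $(6,1),(2,3),(4,5)$, then *applying $ots$* replaces the triangle by a triangle with the six edges attached in pairs $(1,2),(3,4),(5,6)$. $OTS$ is this operation on an $ots$-triangle of crossings of an alternating diagram. All diagrams in a sequence of operations $T$ and $OTS$ are reduced alternating diagrams of prime links. **Theorem.** Let $D$ be a reduced alternating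 diagram of a prime link, $G$ its condensation, and let $A,B,C$ be groups of $D$, of sizes $a,b,c$, that form an $ots$-triangle $O$ in $G$, in the clockwise order $A,C,B$. Let the outgoing strands of this part of $D$ be $1,\dots,6$ in clockwise order, with $6,1$ at $A$, $2,3$ at $C$ and $4,5$ at $B$. For positive integers $m_0,m_1,m_2$ let $D(m_0,m_1,m_2)$ denote the alternating diagram obtained from $D$ when $A\cup B\cup C$ is replaced by a triangle of three subgroups $Y_0,Y_1,Y_2$ of sizes $m_0,m_1,m_2$, in clockwise order, on the same crossings, each with its axis pointing away from the triangle, and with the strands $1,2$ at the outer end of $Y_0$, $3,4$ at that of $Y_1$ and $5,6$ at that of $Y_2$, everything else being unchanged. Say that $(m_0,m_1,m_2)$ is *realized* if some finite sequence of operations $T$ and $OTS$ transforms $D$ into $D'=D(m_0,m_1,m_2)$ and * collapsing $Y_0,Y_1,Y_2$ and the groups of $D$ other than $A,B,C$ in $D'$ gives the graph $G'$ obtained from $G$ by applying $ots$ to $O$; * if the strands $1,2$ do not end at the same crossing of $D$, and neither do $3,4$, nor $5,6$, then these subgroups are the groups of $D'$, so that $G'$ is the condensation of $D'$; * if it does not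 happen that, for some $i$, $m_i=1$ and the two outer strands of $Y_i$ lead to the same group of $D$ and that group has size $1$, then some diagram with condensation $G'$ can be obtained from $D$ by a finite sequence of operations $T$ and $OTS$. Then some triple $(m_0,m_1,m_2)$ is realized. Specifically: (a) if $b$ and $c$ are odd, then $(c,a,b)$ is realized if $a$ is even, and $(b,a,c)$ is realized if $a$ is odd; (b) if $b$ is odd and $a,c$ are even, then $(c,\,a+b-1,\,1)$ is realized; if $a$ and $b$ are even, then $(1,\,a+c-1,\,b)$ is realized. -/

import Mathlib

namespace AlternatingDiagrams

/-- The half-edges of a 4-regular graph with vertex set `V`: the half-edges at the vertex `v` are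
`(v, 0), (v, 1), (v, 2), (v, 3)`, listed in clockwise order around `v`. -/
abbrev Dart (V : Type*) := V × ZMod 4

/-- The half-edge that comes `k` steps after `d` in the clockwise order around the vertex of `d`. -/
def rot {V : Type*} (d : Dart V) (k : ZMod 4) : Dart V := (d.1, d.2 + k)

/-- A 4-regular map (a 4-regular multigraph, loops allowed, together with the cyclic order of the
half-edges around every vertex). `edge d` is the other half of the edge that contains the
half-edge `d`. -/
structure QuarticMap (V : Type*) where
  edge : Dart V → Dart V
  edge_edge : ∀ d, edge (edge d) = d
  edge_ne : ∀ d, edge d ≠ d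

namespace QuarticMap

variable {V : Type*} (M : QuarticMap V)

/-- The permutation whose orbits are the boundary walks of the faces: go along the edge of `d` to
its other end, and leave by the next half-edge in clockwise order. -/
def facePerm : Equiv.Perm (Dart V) where
  toFun d := rot (M.edge d) 1
  invFun d := M.edge (rot d (-1))
  left_inv d := by simp [rot, M.edge_edge]
  right_inv d := by simp [rot, M.edge_edge]

/-- The number of faces. -/
noncomputable def numFaces : ℕ := Nat.card (Quotient (Equiv.Perm.SameCycle.setoid M.facePerm))

/-- 3-edge-connectedness: every edge cut has at least three edges. In particular the graph is
connected. -/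
def ThreeEdgeConnected : Prop :=
  ∀ S : Set V, S.Nonempty → Sᶜ.Nonempty → 3 ≤ {d : Dart V | d.1 ∈ S ∧ (M.edge d).1 ∉ S}.ncard

/-- Euler's formula `#V - #E + #F = 2` with `#E = 2 #V`: for a connected map, this says that the
map is the map of a graph drawn on the sphere. -/
def EulerPlanar : Prop := M.numFaces = Nat.card V + 2

/-- The vertex `d.1` is a nugatory crossing: there is a closed curve that meets the graph only in
this vertex, where it separates the half-edges `d, rot d 1` from the other two half-edges. `W` is
the set of half-edges on one side of the curve. -/
def IsNugatoryAt (d : Dart V) : Prop :=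
  ∃ W : Set (Dart V), (∀ e ∈ W, M.edge e ∈ W) ∧ (∀ e ∈ W, e.1 ≠ d.1 → ∀ k, rot e k ∈ W) ∧
    d ∈ W ∧ rot d 1 ∈ W ∧ rot d 2 ∉ W ∧ rot d 3 ∉ W

/-- The half-edges `t 0, t 1, t 2` start at the three distinct vertices of an `ots`-triangle: at the
`i`-th vertex, `t i` and `rot (t i) 1` point away from the triangle (seen from the triangle, `t i` is
the one on the left), the vertices follow one another clockwise around the triangle, and no edges
except the three sides of the triangle join its vertices. -/
structure IsOtsTriangle (t : Fin 3 → Dart V) : Prop where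
  injective : Function.Injective fun i => (t i).1
  side : ∀ i, M.edge (rot (t i) 2) = rot (t (i + 1)) 3
  left_out : ∀ i j, (M.edge (t i)).1 ≠ (t j).1
  right_out : ∀ i j, (M.edge (rot (t i) 1)).1 ≠ (t j).1

/-- `M'` is the result of applying `ots` to the triangle `t` of `M`: outside of the triangle nothing
changes, and the vertices `s 0, s 1, s 2` of the new triangle (the old vertices, used again) receive
the outward strands in the pairs that are shifted by one step: the strand on the right
at `t i` and the strand on the left at `t (i + 1)` now meet at `s i`. -/
structure IsOts (t : Fin 3 → Dart V) (M' : QuarticMap V) (s : Fin 3 → Dart V) : Prop where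
  vertices : Set.range (fun i => (s i).1) = Set.range (fun i => (t i).1)
  side : ∀ i, M'.edge (rot (s i) 2) = rot (s (i + 1)) 3
  left : ∀ i, M'.edge (s i) = M.edge (rot (t i) 1)
  right : ∀ i, M'.edge (rot (s i) 1) = M.edge (t (i + 1))
  outside : ∀ d, (∀ i, d.1 ≠ (t i).1) → (∀ i, (M.edge d).1 ≠ (t i).1) → M'.edge d = M.edge d

/-- A subgroup: a sequence of distinct vertices in which consecutive vertices are joined by the two
sides of a 2-gon. Every vertex is recorded by one of its half-edges `d`: the two edges towards the
preceding vertex start with `d` and `rot d 1`, and those towards the next one with `rot d 2` and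
`rot d 3`. A sequence with a single vertex is allowed. -/
structure Subgroup where
  darts : List (Dart V)
  ne_nil : darts ≠ []
  nodup : (darts.map Prod.fst).Nodup
  chain : darts.IsChain fun d e => M.edge (rot d 3) = e ∧ M.edge (rot d 2) = rot e 1

namespace Subgroup

variable {M} (r : M.Subgroup)

/-- The number of vertices of the subgroup. -/
def size : ℕ := r.darts.length

/-- The set of vertices of the subgroup. -/
def vertices : Set V := {v | ∃ d ∈ r.darts, d.1 = v}

/-- The four half-edges by which the subgroup, seen as a 4-tangle, is attached to the rest, in
clockwise order: `0, 1` at its first vertex and `2, 3` at its last vertex. -/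
def strand (k : ZMod 4) : Dart V :=
  if k = 0 ∨ k = 1 then rot (r.darts.head r.ne_nil) k else rot (r.darts.getLast r.ne_nil) k

/-- A group is a subgroup that is maximal with respect to its set of vertices. -/
def IsGroup : Prop := ∀ r' : M.Subgroup, r.vertices ⊆ r'.vertices → r'.vertices ⊆ r.vertices

end Subgroup

end QuarticMap

open QuarticMap

/-- `G` is the result of collapsing each member of a decomposition of `M` into pairwise disjoint
subgroups to a single vertex: the node `u` of `G` stands for the subgroup `part u`, and the four
half-edges at `u` are its four outgoing strands, in the same cyclic order. -/
structure Collapse {V U : Type*} (M : QuarticMap V) (G : QuarticMap U) where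
  part : U → M.Subgroup
  offset : U → ZMod 4
  cover : ∀ v, ∃! u, v ∈ (part u).vertices
  compat : ∀ d : Dart U, M.edge ((part d.1).strand (d.2 + offset d.1)) =
    (part (G.edge d).1).strand ((G.edge d).2 + offset (G.edge d).1)

namespace Collapse

variable {V U : Type*} {M : QuarticMap V} {G : QuarticMap U} (κ : Collapse M G)

/-- The half-edge of `M` that the half-edge `d` of `G` stands for. -/
def strand (d : Dart U) : Dart V := (κ.part d.1).strand (d.2 + κ.offset d.1)

/-- `G` is the condensation of `M`: the subgroups that are collapsed are the groups of `M`. -/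
def IsCondensation : Prop := ∀ u, (κ.part u).IsGroup

end Collapse

/-- A reduced alternating diagram of a prime link, with crossing set `V`. At each crossing `v` the
half-edges `(v, 0), (v, 2)` form the lower strand and `(v, 1), (v, 3)` the upper strand. A reduced
alternating diagram represents a prime link exactly when it is 3-edge-connected. -/
structure Diagram (V : Type*) extends QuarticMap V where
  planar : toQuarticMap.EulerPlanar
  alternating : ∀ d, Even (edge d).2 ↔ ¬ Even d.2
  reduced : ∀ d, ¬ toQuarticMap.IsNugatoryAt d
  prime : toQuarticMap.ThreeEdgeConnected

variable {V U : Type*}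

/-- The operation `T`: a subgroup `r` of `D`, seen as a 4-tangle, is turned by 90 degrees (and its
crossings are switched, so that the diagram remains alternating); nothing else changes. -/
def IsTurn (D D' : Diagram V) : Prop :=
  ∃ (r : D.Subgroup) (r' : D'.Subgroup), r'.vertices = r.vertices ∧
    (∀ k, (D.edge (r.strand k)).1 ∉ r.vertices) ∧
    (∀ k, D'.edge (r'.strand k) = D.edge (r.strand (k + 1))) ∧
    ∀ d, d.1 ∉ r.vertices → (D.edge d).1 ∉ r.vertices → D'.edge d = D.edge d

/-- The operation `OTS`: an `ots` operation on an `ots`-triangle of crossings of `D`. -/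
def IsOTSMove (D D' : Diagram V) : Prop :=
  ∃ t s : Fin 3 → Dart V, D.IsOtsTriangle t ∧ D.IsOts t D'.toQuarticMap s

/-- `D'` is the result of a finite sequence of operations `T` and `OTS` on `D`. -/
def Reachable : Diagram V → Diagram V → Prop :=
  Relation.ReflTransGen fun D D' => IsTurn D D' ∨ IsOTSMove D D'

/-- `D'` arises from `D` as follows. The part of `D` that consists of the three groups of the
triangle `t` of `G` has the six outgoing strands `p 1, …, p 6`, in clockwise order, where `p 6, p 1`
leave the first, `p 2, p 3` the second and `p 4, p 5` the third group. It is replaced by three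
subgroups `Y 0, Y 1, Y 2` on the same set of crossings, in clockwise order around a triangle, each
with its axis pointing away from the triangle; the strands at the outer end of `Y 0` are `p 1, p 2`,
those of `Y 1` are `p 3, p 4`, those of `Y 2` are `p 5, p 6`. -/
structure IsReplacement {D : Diagram V} {G : QuarticMap U} (κ : Collapse D.toQuarticMap G)
    (t : Fin 3 → Dart U) (D' : Diagram V) (Y : Fin 3 → D'.Subgroup) : Prop where
  disjoint : Pairwise fun i j => Disjoint (Y i).vertices (Y j).vertices
  vertices : (⋃ i, (Y i).vertices) = ⋃ i, (κ.part (t i).1).vertices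
  side : ∀ i, D'.edge ((Y i).strand 2) = (Y (i + 1)).strand 3
  left : ∀ i, D'.edge ((Y i).strand 0) = D.edge (κ.strand (rot (t i) 1))
  right : ∀ i, D'.edge ((Y i).strand 1) = D.edge (κ.strand (t (i + 1)))
  outside : ∀ d, (∀ i, d.1 ∉ (κ.part (t i).1).vertices) →
    (∀ i, (D.edge d).1 ∉ (κ.part (t i).1).vertices) → D'.edge d = D.edge d

/-- There is a diagram `D'` that is obtained from `D` by a finite sequence of `T` and `OTS`
operations, in which the three groups at the triangle `t` have been replaced by three subgroups
`Y i` of sizes `m i` in the `ots`-shifted position, and which collapses to the graph `G'` that is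
obtained from `G` by applying `ots` to `t`: the subgroups that are collapsed are the `Y i` and the
remaining groups of `D`. They are the groups of `D'`, so that `G'` is the condensation of `D'`,
unless the two outer strands of some `Y i` end at the same crossing; and even then some diagram that
is obtained from `D` by a finite sequence of `T` and `OTS` operations has the condensation `G'`,
unless, for some `i`, a single crossing `Y i` and a single-crossing group of `D` become doubly
connected. -/
def Realizes {D : Diagram V} {G : QuarticMap U} (κ : Collapse D.toQuarticMap G)
    (t : Fin 3 → Dart U) (m : Fin 3 → ℕ) : Prop :=
  ∃ (D' : Diagram V) (Y : Fin 3 → D'.Subgroup) (G' : QuarticMap U) (s : Fin 3 → Dart U)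
    (κ' : Collapse D'.toQuarticMap G'),
    Reachable D D' ∧
    IsReplacement κ t D' Y ∧
    (∀ i, (Y i).size = m i) ∧
    G.IsOts t G' s ∧
    (∀ i, κ'.part (s i).1 = Y i) ∧
    (∀ u, (∀ i, u ≠ (t i).1) → (κ'.part u).darts = (κ.part u).darts) ∧
    ((∀ i, (D.edge (κ.strand (rot (t i) 1))).1 ≠ (D.edge (κ.strand (t (i + 1)))).1) →
      κ'.IsCondensation) ∧
    ((∀ i, (G.edge (rot (t i) 1)).1 = (G.edge (t (i + 1))).1 →
        2 ≤ m i ∨ 2 ≤ (κ.part (G.edge (t (i + 1))).1).size) →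
      ∃ (D'' : Diagram V) (κ'' : Collapse D''.toQuarticMap G'),
        Reachable D D'' ∧ κ''.IsCondensation)

end AlternatingDiagrams

open AlternatingDiagrams

namespace AlternatingDiagrams

open QuarticMap

/-! ### Half-edges, faces, edge cuts and nugatory crossings -/

section

variable {V U : Type*}

/-! The operation T turns the subgroups at a triangle at will, so only their sizes matter. Listed
clockwise, as in (a, c, b), the sizes before and after are related by `Moves`: a triangle of
subgroups with sizes x can be transformed into one with sizes y in the `ots`-shifted position,
whatever the rest of the diagram is. This relation is invariant under rotating the triangle
(`Moves.rotate`), contains (1,1,1) → (1,1,1), which is OTS (`Moves.one`), and obeys one composition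
rule (`Moves.comp`): from (k,c,b) → (u,p,v) and (l,u,v) → (w₀,w₁,w₂) it follows that (l+k,c,b) →
(w₀,p+w₁,w₂). Indeed, when the inner k crossings of the first subgroup have been used up, its outer
l crossings form a triangle with the subgroups of sizes u and v, and what then arrives on the far
side prolongs the subgroup of size p.

The rest is parity arithmetic. Pushing crossings through one at a time gives (n,1,1) → (1,n,1).
Rotated, this says that a single crossing can pass between a single crossing and a subgroup of size
m, which swap places. By `Moves.iterate`, n crossings can then pass, and the two neighbours end up
swapped exactly when n is odd. Rotating once more, a single crossing can pass between two subgroups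
of odd sizes, and a second iteration gives (a). For (b), one crossing of A together with an even
neighbour is used to put the remaining neighbour opposite A; a single crossing is left in its place,
and the other a - 1 crossings, an odd number, pass beside that crossing and are added to the
subgroup opposite. Two of the three parities always agree, so up to rotation some case applies.

Both operations are realized by conjugating the edge involution with a permutation of half-edges at
the crossings concerned. The number of faces is preserved because it does not increase and the
operations are invertible; 3-edge-connectedness comes from `ThreeEdgeConnected.of_agreeOff`, and it
excludes nugatory crossings.

As to condensations: a collapse is the condensation exactly when no 2-gon of the collapsed graph
comes from a 2-gon of crossings (`Collapse.IsBadBigon`). After the move such 2-gons occur only at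
the outer ends of the new subgroups, and each is destroyed by turning a subgroup with at least two
crossings on one of its sides. -/

@[simp] lemma rot_fst (d : Dart V) (k : ZMod 4) : (rot d k).1 = d.1 := rfl

@[simp] lemma rot_rot (d : Dart V) (a b : ZMod 4) : rot (rot d a) b = rot d (a + b) := by
  simp [rot, add_assoc]

@[simp] lemma rot_zero (d : Dart V) : rot d 0 = d := by simp [rot]

lemma rot_inj {d : Dart V} {a b : ZMod 4} : rot d a = rot d b ↔ a = b := by
  simp [rot]

lemma exists_eq_rot {d e : Dart V} (h : d.1 = e.1) : ∃ k, d = rot e k :=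
  ⟨d.2 - e.2, by ext <;> simp [rot, h]⟩

lemma forall_zmod_four {p : ZMod 4 → Prop} (h0 : p 0) (h1 : p 1) (h2 : p 2) (h3 : p 3) :
    ∀ k, p k := by
  intro k
  have : k = 0 ∨ k = 1 ∨ k = 2 ∨ k = 3 := by revert k; decide
  rcases this with rfl | rfl | rfl | rfl <;> assumption

lemma even_add_one_zmod_four (k : ZMod 4) : Even (k + 1) ↔ ¬ Even k := by
  unfold Even; revert k; decide

lemma even_add_two_zmod_four (k : ZMod 4) : Even (k + 2) ↔ Even k := by
  unfold Even; revert k; decide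

lemma even_add_three_zmod_four (k : ZMod 4) : Even (k + 3) ↔ ¬ Even k := by
  unfold Even; revert k; decide

namespace QuarticMap

variable {M M' : QuarticMap V}

lemma edge_eq_comm {x y : Dart V} : M.edge x = y ↔ M.edge y = x :=
  ⟨fun h => by rw [← h, M.edge_edge], fun h => by rw [← h, M.edge_edge]⟩

lemma edge_injective : Function.Injective M.edge := fun x y h => by
  rw [← M.edge_edge x, h, M.edge_edge]

lemma facePerm_apply (d : Dart V) : M.facePerm d = rot (M.edge d) 1 := rfl

lemma sameCycle_facePerm (d : Dart V) : M.facePerm.SameCycle (M.facePerm d) d :=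
  (Equiv.Perm.sameCycle_apply_left).2 (Equiv.Perm.SameCycle.refl _ _)

/-- The two maps agree on the edges that do not meet `S`. -/
def AgreeOff (S : Set V) (M M' : QuarticMap V) : Prop :=
  ∀ d, d.1 ∉ S → (M.edge d).1 ∉ S → M'.edge d = M.edge d

lemma AgreeOff.refl (S : Set V) (M : QuarticMap V) : AgreeOff S M M := fun _ _ _ => rfl

lemma AgreeOff.mono {S T : Set V} (h : AgreeOff S M M') (hST : S ⊆ T) : AgreeOff T M M' :=
  fun d h1 h2 => h d (fun h => h1 (hST h)) (fun h => h2 (hST h))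

lemma AgreeOff.trans {S : Set V} {M'' : QuarticMap V} (h : AgreeOff S M M')
    (h' : AgreeOff S M' M'') : AgreeOff S M M'' := fun d h1 h2 => by
  rw [h' d h1 (by rwa [h d h1 h2]), h d h1 h2]

/-- A map of half-edges that respects faces and reaches every face bounds the number of faces. -/
lemma numFaces_le [Finite V] (α : Dart V → Dart V)
    (h : ∀ x, M'.facePerm.SameCycle (α (M.facePerm x)) (α x))
    (hs : ∀ y, ∃ x, M'.facePerm.SameCycle (α x) y) : M'.numFaces ≤ M.numFaces := by
  have hpow : ∀ (n : ℕ) x, M'.facePerm.SameCycle (α ((M.facePerm ^ n) x)) (α x) := by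
    intro n
    induction n with
    | zero => intro x; exact Equiv.Perm.SameCycle.refl _ _
    | succ n ih =>
      intro x
      rw [pow_succ, Equiv.Perm.mul_apply]
      exact (ih _).trans (h x)
  have hresp : ∀ x y, M.facePerm.SameCycle x y → M'.facePerm.SameCycle (α x) (α y) := by
    rintro x y ⟨i, rfl⟩
    rcases i.eq_nat_or_neg with ⟨n, rfl | rfl⟩
    · exact (by simpa using hpow n x : M'.facePerm.SameCycle _ _).symm
    · have := hpow n ((M.facePerm ^ (-(n : ℤ))) x)
      simpa using this
  let F : Quotient (Equiv.Perm.SameCycle.setoid M.facePerm) →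
      Quotient (Equiv.Perm.SameCycle.setoid M'.facePerm) := Quotient.map α hresp
  refine Nat.card_le_card_of_surjective F ?_
  intro q
  induction q using Quotient.inductionOn with
  | h y =>
    obtain ⟨x, hx⟩ := hs y
    exact ⟨Quotient.mk _ x, Quotient.sound hx⟩

/-- The half-edges that leave `S`. -/
def cut (M : QuarticMap V) (S : Set V) : Set (Dart V) := {d | d.1 ∈ S ∧ (M.edge d).1 ∉ S}

lemma ThreeEdgeConnected.not_cut_subset (h : M.ThreeEdgeConnected) {S : Set V}
    (h1 : S.Nonempty) (h2 : Sᶜ.Nonempty) (x y : Dart V) (hxy : ∀ d ∈ M.cut S, d = x ∨ d = y) :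
    False := by
  have h3 : 3 ≤ (M.cut S).ncard := h S h1 h2
  have h4 : (M.cut S).ncard ≤ ({x, y} : Set (Dart V)).ncard :=
    Set.ncard_le_ncard (fun d hd => by simpa using hxy d hd) (by simp)
  have h5 := Set.ncard_insert_le x ({y} : Set (Dart V))
  simp at h5
  omega

lemma cut_compl_ncard (S : Set V) : (M.cut Sᶜ).ncard = (M.cut S).ncard := by
  refine Set.ncard_congr (fun d _ => M.edge d) ?_ ?_ ?_
  · rintro d ⟨h1, h2⟩
    exact ⟨by simpa using h2, by simpa [M.edge_edge] using h1⟩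
  · intro a b _ _ hab
    exact edge_injective hab
  · rintro d ⟨h1, h2⟩
    exact ⟨M.edge d, ⟨by simpa using h2, by simpa [M.edge_edge] using h1⟩, M.edge_edge d⟩

/-- If a part `S` of a 3-edge-connected map is replaced by something else, then it remains
3-edge-connected, provided that every small cut that separates vertices of `S` consists of
two edges inside `S` and has a side where at most two strands leave `S`. -/
lemma ThreeEdgeConnected.of_agreeOff [Finite V] (h : M.ThreeEdgeConnected) {S : Set V}
    (hagree : AgreeOff S M M')
    (hmem : ∀ d, d.1 ∉ S → (M.edge d).1 ∈ S → (M'.edge d).1 ∈ S)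
    (hsplit : ∀ T : Set V, (S ∩ T).Nonempty → (S \ T).Nonempty → (M'.cut T).ncard < 3 →
      (∀ d ∈ M'.cut T, d.1 ∈ S ∧ (M'.edge d).1 ∈ S) ∧
      ∃ T', (T' = T ∨ T' = Tᶜ) ∧ ∃ x y, (x.1 ∉ S ∧ (M'.edge x).1 ∈ S ∩ T') ∧
        ∀ d, d.1 ∉ S → (M'.edge d).1 ∈ S ∩ T' → d = x ∨ d = y) :
    M'.ThreeEdgeConnected := by
  have key : ∀ T : Set V, T.Nonempty → Tᶜ.Nonempty → S ∩ T = ∅ → 3 ≤ (M'.cut T).ncard := by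
    intro T h1 h2 h0
    refine (h T h1 h2).trans (Set.ncard_le_ncard ?_ (Set.toFinite _))
    rintro d ⟨hd1, hd2⟩
    have hdS : d.1 ∉ S := fun hd => by
      have : d.1 ∈ S ∩ T := ⟨hd, hd1⟩
      simp [h0] at this
    refine ⟨hd1, ?_⟩
    by_cases hdS' : (M.edge d).1 ∈ S
    · intro hT
      have : (M'.edge d).1 ∈ S ∩ T := ⟨hmem d hdS hdS', hT⟩
      simp [h0] at this
    · rwa [hagree d hdS hdS']
  intro T h1 h2
  change 3 ≤ (M'.cut T).ncard
  by_contra hlt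
  rw [not_le] at hlt
  -- If T does not split S, then T or its complement misses S, and by `key` its cut in M' has at
  -- least three edges.
  by_cases hA : (S ∩ T).Nonempty
  swap
  · exact absurd (key T h1 h2 (Set.not_nonempty_iff_eq_empty.1 hA)) (by omega)
  by_cases hB : (S \ T).Nonempty
  swap
  · have := key Tᶜ h2 (by simpa using h1) (Set.not_nonempty_iff_eq_empty.1 hB)
    rw [cut_compl_ncard] at this
    omega
  obtain ⟨hin, T', hT', x, y, ⟨hx, hxT⟩, hxy⟩ := hsplit T hA hB hlt
  have hstay : ∀ d, d.1 ∉ S → (d.1 ∈ T' ↔ (M'.edge d).1 ∈ T') := by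
    have : ∀ d, d.1 ∉ S → (d.1 ∈ T ↔ (M'.edge d).1 ∈ T) := by
      intro d hd
      constructor
      · intro h1
        by_contra h2
        exact hd (hin d ⟨h1, h2⟩).1
      · intro h1
        by_contra h2
        have := (hin (M'.edge d) ⟨h1, by rwa [M'.edge_edge]⟩).2
        rw [M'.edge_edge] at this
        exact hd this
    rcases hT' with rfl | rfl
    · exact this
    · intro d hd
      simp [this d hd]
  -- In M' no edge meeting the complement of S crosses the boundary of T'. Hence an edge of M that
  -- leaves T' \ S must enter S, and in M' its half-edge in T' \ S leads into S ∩ T': there are at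
  -- most the two such strands x and y.
  refine h.not_cut_subset (S := T' \ S) ⟨x.1, (hstay x hx).2 hxT.2, hx⟩
    (hA.mono fun v hv => by simp [hv.1]) x y ?_
  rintro d ⟨⟨hdT, hdS⟩, hd2⟩
  refine hxy d hdS ⟨?_, (hstay d hdS).1 hdT⟩
  refine hmem d hdS ?_
  by_contra hne
  refine hd2 ⟨?_, hne⟩
  rw [← hagree d hdS hne]
  exact (hstay d hdS).1 hdT

/-- The vertices strictly on one side of the closed curve are joined to the rest by at most the two
edges at `d` and `rot d 1`. If there are no such vertices, then these half-edges form a loop, and at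
most two edges leave the crossing itself. -/
lemma ThreeEdgeConnected.not_isNugatoryAt [Nontrivial V] (h : M.ThreeEdgeConnected) (d : Dart V) :
    ¬ M.IsNugatoryAt d := by
  rintro ⟨W, hedge, hrot, h0, h1, h2, h3⟩
  by_cases hS : ∃ e ∈ W, e.1 ≠ d.1
  · obtain ⟨e, heW, hed⟩ := hS
    refine h.not_cut_subset (S := {w | w ≠ d.1 ∧ ∀ k, (w, k) ∈ W})
      ⟨e.1, hed, fun k => ?_⟩ ⟨d.1, fun h => h.1 rfl⟩ (M.edge d) (M.edge (rot d 1)) ?_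
    · have := hrot e heW hed (k - e.2)
      simpa [rot] using this
    · rintro x ⟨⟨hx1, hx2⟩, hx3⟩
      have hxW : M.edge x ∈ W := hedge x (hx2 x.2)
      by_cases hv : (M.edge x).1 = d.1
      · obtain ⟨k, hk⟩ := exists_eq_rot hv
        rw [← M.edge_edge x, hk]
        rw [hk] at hxW
        clear hx3 hv hk
        revert k
        refine forall_zmod_four ?_ ?_ ?_ ?_
        · intro; simp
        · intro; simp
        · intro h; exact absurd h h2
        · intro h; exact absurd h h3
      · refine absurd ⟨hv, fun k => ?_⟩ hx3
        have := hrot _ hxW hv (k - (M.edge x).2)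
        simpa [rot] using this
  · push Not at hS
    obtain ⟨w, hw⟩ := exists_ne d.1
    refine h.not_cut_subset (S := {d.1}) (by simp) ⟨w, by simpa using hw⟩ (rot d 2) (rot d 3) ?_
    rintro x ⟨hx1, hx2⟩
    obtain ⟨k, rfl⟩ := exists_eq_rot hx1
    clear hx1
    revert k
    refine forall_zmod_four ?_ ?_ ?_ ?_
    · intro h; exact absurd (hS _ (hedge _ (by simpa using h0))) h
    · intro h; exact absurd (hS _ (hedge _ h1)) h
    · intro; simp
    · intro; simp

end QuarticMap

end

/-! ### Rewiring at chosen vertices, and the `ots` operation -/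

section

variable {V U ι : Type*}

/-- The half-edges at the vertices of a family of half-edges with distinct vertices. -/
def cellEmb (c : ι → Dart V) (hc : Function.Injective fun i => (c i).1) :
    ι × ZMod 4 ↪ Dart V where
  toFun p := rot (c p.1) p.2
  inj' := by
    rintro ⟨i, a⟩ ⟨j, b⟩ h
    have h1 : (rot (c i) a).1 = (rot (c j) b).1 := congrArg (fun d : Dart V => d.1) h
    obtain rfl : i = j := hc h1
    have hab : a = b := rot_inj.1 h
    rw [hab]

lemma notMem_range_cellEmb {c : ι → Dart V} {hc : Function.Injective fun i => (c i).1}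
    {d : Dart V} (hd : ∀ i, d.1 ≠ (c i).1) : d ∉ Set.range (cellEmb c hc) := by
  rintro ⟨p, rfl⟩
  exact hd p.1 rfl

namespace QuarticMap

variable {M M' : QuarticMap V}

/-- The map obtained by a permutation of the half-edges. -/
def conj (M : QuarticMap V) (σ : Equiv.Perm (Dart V)) : QuarticMap V where
  edge d := σ.symm (M.edge (σ d))
  edge_edge d := by simp [M.edge_edge]
  edge_ne d h := M.edge_ne (σ d) (by simpa using congrArg σ h)

/-- The map obtained by a permutation of the half-edges at certain vertices. -/
noncomputable def rewire (M : QuarticMap V) (c : ι → Dart V)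
    (hc : Function.Injective fun i => (c i).1) (τ : Equiv.Perm (ι × ZMod 4)) : QuarticMap V :=
  M.conj (τ.viaEmbedding (cellEmb c hc))

lemma rewire_edge_of_eq {c : ι → Dart V} {hc : Function.Injective fun i => (c i).1}
    {τ : Equiv.Perm (ι × ZMod 4)} {d e : Dart V}
    (h : M.edge (τ.viaEmbedding (cellEmb c hc) d) = τ.viaEmbedding (cellEmb c hc) e) :
    (M.rewire c hc τ).edge d = e := by
  simp [rewire, conj, h]

lemma viaEmbedding_cell {c : ι → Dart V} {hc : Function.Injective fun i => (c i).1}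
    (τ : Equiv.Perm (ι × ZMod 4)) (i : ι) (k : ZMod 4) :
    τ.viaEmbedding (cellEmb c hc) (rot (c i) k) = rot (c (τ (i, k)).1) (τ (i, k)).2 :=
  Equiv.Perm.viaEmbedding_apply τ (cellEmb c hc) (i, k)

lemma viaEmbedding_of_ne {c : ι → Dart V} {hc : Function.Injective fun i => (c i).1}
    (τ : Equiv.Perm (ι × ZMod 4)) {d : Dart V} (hd : ∀ i, d.1 ≠ (c i).1) :
    τ.viaEmbedding (cellEmb c hc) d = d :=
  Equiv.Perm.viaEmbedding_apply_of_notMem τ (cellEmb c hc) d (notMem_range_cellEmb hd)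

lemma rewire_edge_of_ne {c : ι → Dart V} {hc : Function.Injective fun i => (c i).1}
    {τ : Equiv.Perm (ι × ZMod 4)} {d : Dart V} (hd : ∀ i, d.1 ≠ (c i).1)
    (hd' : ∀ i, (M.edge d).1 ≠ (c i).1) : (M.rewire c hc τ).edge d = M.edge d := by
  apply rewire_edge_of_eq
  rw [viaEmbedding_of_ne τ hd, viaEmbedding_of_ne τ hd']

/-- The permutation of the half-edges of a triangle behind the `ots` operation. -/
def otsPerm : Equiv.Perm (Fin 3 × ZMod 4) where
  -- The arguments are half-edges of the new map, the values half-edges of the old one. With `s i =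
  -- rot (t i) 1`, the new outward pair at `s i` consists of (i,1) and (i,2); it takes over the
  -- right strand at `t i` and the left strand at `t (i + 1)`.
  toFun p := match p with
    | (i, 0) => (i, 3)
    | (i, 1) => (i, 1)
    | (i, 2) => (i + 1, 0)
    | (i, 3) => (i, 2)
  invFun p := match p with
    | (i, 0) => (i + 2, 2)
    | (i, 1) => (i, 1)
    | (i, 2) => (i, 3)
    | (i, 3) => (i, 0)
  left_inv := by unfold Function.LeftInverse; decide
  right_inv := by unfold Function.RightInverse Function.LeftInverse; decide

/-- The map obtained by applying `ots` to a triangle. -/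
noncomputable def otsMap (M : QuarticMap V) (t : Fin 3 → Dart V)
    (ht : Function.Injective fun i => (t i).1) : QuarticMap V :=
  M.rewire t ht otsPerm

lemma IsOtsTriangle.isOts_otsMap {t : Fin 3 → Dart V} (ht : M.IsOtsTriangle t) :
    M.IsOts t (M.otsMap t ht.injective) fun i => rot (t i) 1 where
  vertices := rfl
  side i := by
    apply rewire_edge_of_eq
    simp only [rot_rot, viaEmbedding_cell]
    exact ht.side i
  left i := by
    apply rewire_edge_of_eq
    rw [viaEmbedding_cell, viaEmbedding_of_ne _ (ht.right_out i)]
    rfl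
  right i := by
    apply rewire_edge_of_eq
    rw [rot_rot, viaEmbedding_cell, viaEmbedding_of_ne _ (ht.left_out (i + 1))]
    change M.edge (rot (t (i + 1)) 0) = _
    rw [rot_zero]
  outside d h1 h2 := rewire_edge_of_ne h1 h2

lemma IsOts.isOtsTriangle {t s : Fin 3 → Dart V} (ht : M.IsOtsTriangle t)
    (h : M.IsOts t M' s) : M'.IsOtsTriangle s where
  injective := by
    have hcard : Fintype.card (Fin 3) = (Set.range fun i => (t i).1).ncard := by
      rw [← Set.image_univ, Set.ncard_image_of_injective _ ht.injective]
      simp [Set.ncard_univ]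
    rw [← h.vertices, ← Set.image_univ] at hcard
    have := Set.injOn_of_ncard_image_eq (s := (Set.univ : Set (Fin 3)))
      (f := fun i => (s i).1) (by rw [← hcard]; simp [Set.ncard_univ])
    exact Set.injOn_univ.1 this
  side := h.side
  left_out i j := by
    obtain ⟨k, hk⟩ : (s j).1 ∈ Set.range fun i => (t i).1 := h.vertices ▸ ⟨j, rfl⟩
    rw [h.left, ← hk]
    exact ht.right_out i k
  right_out i j := by
    obtain ⟨k, hk⟩ : (s j).1 ∈ Set.range fun i => (t i).1 := h.vertices ▸ ⟨j, rfl⟩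
    rw [h.right, ← hk]
    exact ht.left_out _ k

lemma IsOtsTriangle.side' {t : Fin 3 → Dart V} (ht : M.IsOtsTriangle t) (i : Fin 3) :
    M.edge (rot (t (i + 1)) 3) = rot (t i) 2 := edge_eq_comm.1 (ht.side i)

lemma add_one_add_two (i : Fin 3) : i + 1 + 2 = i := by revert i; decide

lemma add_two_add_one (i : Fin 3) : i + 2 + 1 = i := by revert i; decide

lemma eq_add_one_or_eq_add_two {i j : Fin 3} : j ≠ i → j = i + 1 ∨ j = i + 2 := by
  revert i j; decide

lemma exists_eq_add_one (i : Fin 3) : ∃ j, i = j + 1 := by revert i; decide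

/-- An edge from outside to a vertex of the triangle ends with one of the outgoing strands. -/
lemma IsOtsTriangle.eq_of_edge {t : Fin 3 → Dart V} (ht : M.IsOtsTriangle t) {d : Dart V}
    (hd : ∀ i, d.1 ≠ (t i).1) {i : Fin 3} (hi : (M.edge d).1 = (t i).1) :
    d = M.edge (t i) ∨ d = M.edge (rot (t i) 1) := by
  obtain ⟨k, hk⟩ := exists_eq_rot hi
  have hd' : d = M.edge (rot (t i) k) := by rw [← hk, M.edge_edge]
  clear hi hk
  subst hd'
  revert k
  refine forall_zmod_four ?_ ?_ ?_ ?_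
  · simp
  · simp
  · intro h; rw [ht.side] at h; exact absurd rfl (h (i + 1))
  · obtain ⟨j, rfl⟩ := exists_eq_add_one i
    intro h; rw [ht.side'] at h; exact absurd rfl (h j)

lemma IsOts.ne {t s : Fin 3 → Dart V} (h : M.IsOts t M' s) {v : V} :
    (∀ i, v ≠ (s i).1) ↔ ∀ i, v ≠ (t i).1 := by
  have : (v ∉ Set.range fun i => (s i).1) ↔ v ∉ Set.range fun i => (t i).1 := by
    rw [h.vertices]
  simpa [eq_comm] using this

lemma IsOts.edge_mem {t s : Fin 3 → Dart V} (ht : M.IsOtsTriangle t)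
    (h : M.IsOts t M' s) {d : Dart V} (hd : ∀ i, d.1 ≠ (t i).1) {i : Fin 3}
    (hi : (M.edge d).1 = (t i).1) : ∃ j, (M'.edge d).1 = (s j).1 := by
  rcases ht.eq_of_edge hd hi with rfl | rfl
  · obtain ⟨j, rfl⟩ := exists_eq_add_one i
    exact ⟨j, by rw [← h.right, M'.edge_edge]; rfl⟩
  · exact ⟨i, by rw [← h.left, M'.edge_edge]⟩

/-- A second shift of the pairs restores the original pairing, only with the numbering of the
vertices advanced by one. So inequalities between M and M' need to be shown in one direction only.
-/
lemma IsOts.symm {t s : Fin 3 → Dart V} (ht : M.IsOtsTriangle t) (h : M.IsOts t M' s) :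
    M'.IsOts s M fun i => t (i + 1) where
  vertices := by
    rw [h.vertices]
    exact (Equiv.addRight (1 : Fin 3)).surjective.range_comp (fun i => (t i).1)
  side i := ht.side _
  left i := (h.right i).symm
  right i := (h.left _).symm
  outside d h1 h2 := by
    have h1' := h.ne.1 h1
    refine (h.outside d h1' fun i hi => ?_).symm
    obtain ⟨j, hj⟩ := h.edge_mem ht h1' hi
    exact h2 j hj

lemma IsOts.numFaces_le [Finite V] {t s : Fin 3 → Dart V} (ht : M.IsOtsTriangle t)
    (h : M.IsOts t M' s) : M'.numFaces ≤ M.numFaces := by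
  have hs := h.isOtsTriangle ht
  -- Each half-edge is sent into the corresponding face of the new map: the triangle (index 3) to
  -- the triangle, the face between the outward strands of `t i` (index 1) to the face that now
  -- borders a side of the triangle, and the face across the side from `t i` to `t (i + 1)` to the
  -- corner at `s i`.
  let val : Fin 3 × ZMod 4 → Dart V := fun p => match p with
    | (i, 0) => rot (s (i + 2)) 1
    | (i, 1) => s i
    | (i, 2) => rot (s i) 1
    | (i, 3) => rot (s i) 3
  let α : Dart V → Dart V := Function.extend (cellEmb t ht.injective) val id
  have hα : ∀ i k, α (rot (t i) k) = val (i, k) := fun i k =>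
    (cellEmb t ht.injective).injective.extend_apply val id (i, k)
  have hα0 : ∀ i, α (t (i + 1)) = rot (s i) 1 := fun i => by
    have := hα (i + 1) 0
    rw [rot_zero] at this
    rw [this]
    change rot (s (i + 1 + 2)) 1 = _
    rw [add_one_add_two]
  have hα1 : ∀ i, α (rot (t i) 1) = s i := fun i => hα i 1
  have hα2 : ∀ i, α (rot (t i) 2) = rot (s i) 1 := fun i => hα i 2
  have hα3 : ∀ i, α (rot (t i) 3) = rot (s i) 3 := fun i => hα i 3
  have hαo : ∀ d : Dart V, (∀ i, d.1 ≠ (t i).1) → α d = d := fun d hd =>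
    Function.extend_apply' _ _ _ (notMem_range_cellEmb hd)
  have hstep : ∀ {x y : Dart V}, rot (M'.edge x) 1 = y → M'.facePerm.SameCycle y x := by
    rintro x y rfl
    exact sameCycle_facePerm x
  have h4 : (3 : ZMod 4) + 1 = 0 := by decide
  have h21 : (2 : ZMod 4) + 1 = 3 := by decide
  have h11 : (1 : ZMod 4) + 1 = 2 := by decide
  apply QuarticMap.numFaces_le α
  · intro d
    rw [facePerm_apply]
    by_cases hd : ∀ i, d.1 ≠ (t i).1
    · rw [hαo d hd]
      by_cases hd' : ∀ i, (M.edge d).1 ≠ (t i).1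
      · rw [hαo (rot _ 1) hd']
        exact hstep (by rw [h.outside d hd hd'])
      · push Not at hd'
        obtain ⟨i, hi⟩ := hd'
        rcases ht.eq_of_edge hd hi with rfl | rfl
        · obtain ⟨j, rfl⟩ := exists_eq_add_one i
          rw [M.edge_edge, hα1]
          refine (hstep (x := rot (s j) 2) ?_).trans (hstep ?_)
          · rw [hs.side, rot_rot, h4, rot_zero]
          · rw [← h.right, M'.edge_edge, rot_rot, h11]
        · rw [M.edge_edge, rot_rot, h11, hα2]
          refine hstep ?_
          rw [← h.left, M'.edge_edge]
    · push Not at hd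
      obtain ⟨i, hi⟩ := hd
      obtain ⟨k, rfl⟩ := exists_eq_rot hi
      clear hi
      revert k
      refine forall_zmod_four ?_ ?_ ?_ ?_
      · obtain ⟨j, rfl⟩ := exists_eq_add_one i
        rw [rot_zero, hα0, hαo (rot _ 1) (ht.left_out _)]
        exact hstep (by rw [h.right])
      · rw [hα1, hαo (rot _ 1) (ht.right_out _)]
        exact hstep (by rw [h.left])
      · rw [ht.side, rot_rot, h4, rot_zero, hα0, hα2]
      · obtain ⟨j, rfl⟩ := exists_eq_add_one i
        rw [ht.side', rot_rot, h21, hα3, hα3]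
        exact hstep (by rw [hs.side', rot_rot, h21])
  · intro y
    by_cases hy : ∀ i, y.1 ≠ (s i).1
    · exact ⟨y, by rw [hαo y (h.ne.1 hy)]⟩
    · push Not at hy
      obtain ⟨i, hi⟩ := hy
      obtain ⟨k, rfl⟩ := exists_eq_rot hi
      clear hi
      revert k
      refine forall_zmod_four ?_ ?_ ?_ ?_
      · exact ⟨rot (t i) 1, by rw [hα1, rot_zero]⟩
      · exact ⟨rot (t i) 2, by rw [hα2]⟩
      · exact ⟨rot (t (i + 1)) 1, by
          rw [hα1]; exact hstep (by rw [hs.side, rot_rot, h4, rot_zero])⟩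
      · exact ⟨rot (t i) 3, by rw [hα3]⟩

lemma IsOts.numFaces_eq [Finite V] {t s : Fin 3 → Dart V} (ht : M.IsOtsTriangle t)
    (h : M.IsOts t M' s) : M'.numFaces = M.numFaces :=
  le_antisymm (h.numFaces_le ht) ((h.symm ht).numFaces_le (h.isOtsTriangle ht))

/-- Alternation says that every edge joins half-edges of opposite parity. All `t i` have the same
parity, so giving all `s i` the other one makes the reattached strands fit. -/
lemma IsOts.alternating {t s : Fin 3 → Dart V} (ht : M.IsOtsTriangle t)
    (h : M.IsOts t M' s) (hpar : ∀ i, Even (s i).2 ↔ ¬ Even (t i).2)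
    (halt : ∀ d, Even (M.edge d).2 ↔ ¬ Even d.2) (d : Dart V) :
    Even (M'.edge d).2 ↔ ¬ Even d.2 := by
  have hs := h.isOtsTriangle ht
  have htt : ∀ i, Even (t (i + 1)).2 ↔ Even (t i).2 := fun i => by
    have := halt (rot (t i) 2)
    rw [ht.side] at this
    simp only [rot, even_add_three_zmod_four, even_add_two_zmod_four] at this
    tauto
  have hin : ∀ i k, Even (M'.edge (rot (s i) k)).2 ↔ ¬ Even (rot (s i) k).2 := by
    intro i
    refine forall_zmod_four ?_ ?_ ?_ ?_
    · rw [rot_zero, h.left, halt, hpar]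
      simp only [rot, even_add_one_zmod_four, not_not]
    · rw [h.right, halt, htt]
      simp only [rot, even_add_one_zmod_four, hpar]
      tauto
    · rw [h.side]
      simp only [rot, even_add_three_zmod_four, even_add_two_zmod_four, hpar, htt]
    · obtain ⟨j, rfl⟩ := exists_eq_add_one i
      rw [hs.side']
      simp only [rot, even_add_three_zmod_four, even_add_two_zmod_four, hpar, htt]
      tauto
  by_cases hd : ∀ i, d.1 ≠ (s i).1
  · by_cases hd' : ∀ i, (M'.edge d).1 ≠ (s i).1
    · rw [← (h.symm ht).outside d hd hd', halt]
    · push Not at hd'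
      obtain ⟨i, hi⟩ := hd'
      obtain ⟨k, hk⟩ := exists_eq_rot hi
      have := hin i k
      rw [← hk, M'.edge_edge] at this
      tauto
  · push Not at hd
    obtain ⟨i, hi⟩ := hd
    obtain ⟨k, rfl⟩ := exists_eq_rot hi
    exact hin i k

lemma IsOts.agreeOff {t s : Fin 3 → Dart V} (h : M.IsOts t M' s) :
    AgreeOff (Set.range fun i => (t i).1) M M' := fun d h1 h2 =>
  h.outside d (fun i hi => h1 ⟨i, hi.symm⟩) fun i hi => h2 ⟨i, hi.symm⟩

/-- A set with fewer than three elements has no elements besides two given ones. -/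
lemma eq_or_eq_of_ncard_lt_three {α : Type*} [Finite α] {S : Set α} (h : S.ncard < 3) {a b : α}
    (ha : a ∈ S) (hb : b ∈ S) (hab : a ≠ b) {x : α} (hx : x ∈ S) : x = a ∨ x = b := by
  by_contra hne
  push Not at hne
  have h3 : ({x, a, b} : Set α).ncard = 3 := Set.ncard_eq_three.2
    ⟨x, a, b, hne.1, hne.2, hab, rfl⟩
  have : ({x, a, b} : Set α).ncard ≤ S.ncard := Set.ncard_le_ncard (by
    rintro y (rfl | rfl | rfl) <;> assumption) (Set.toFinite _)
  omega

lemma exists_singleton_side (p : Fin 3 → Prop) (h1 : ∃ i, p i) (h2 : ∃ i, ¬ p i) :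
    ∃ i, (p (i + 1) ↔ ¬ p i) ∧ (p (i + 2) ↔ ¬ p i) := by
  classical
  have key : ∀ b : Fin 3 → Bool, (∃ i, b i = true) → (∃ i, ¬ b i = true) →
      ∃ i, (b (i + 1) = true ↔ ¬ b i = true) ∧ (b (i + 2) = true ↔ ¬ b i = true) := by decide
  simpa using key (fun i => decide (p i)) (by simpa using h1) (by simpa using h2)

/-- A cut that separates vertices of the triangle isolates one of them from the other two, so it
contains two sides of the triangle. A small cut therefore consists of just these sides, and the
isolated vertex has only two outgoing strands. -/
lemma IsOts.threeEdgeConnected [Finite V] {t s : Fin 3 → Dart V} (ht : M.IsOtsTriangle t)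
    (h : M.IsOts t M' s) (h3 : M.ThreeEdgeConnected) : M'.ThreeEdgeConnected := by
  have hs := h.isOtsTriangle ht
  refine h3.of_agreeOff h.agreeOff ?_ ?_
  · rintro d hd ⟨i, hi⟩
    obtain ⟨j, hj⟩ := h.edge_mem ht (fun i hi => hd ⟨i, hi.symm⟩) hi.symm
    exact h.vertices ▸ ⟨j, hj.symm⟩
  · rw [← h.vertices]
    rintro T ⟨_, ⟨i1, rfl⟩, hi1⟩ ⟨_, ⟨i2, rfl⟩, hi2⟩ hcut
    obtain ⟨i, ha, hb⟩ := exists_singleton_side (fun i => (s i).1 ∈ T) ⟨i1, hi1⟩ ⟨i2, hi2⟩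
    have hside : M'.edge (rot (s i) 3) = rot (s (i + 2)) 2 := by
      rw [edge_eq_comm, hs.side]
      rw [add_two_add_one]
    obtain ⟨T', hT', hiT', hT'cut, haT', hbT'⟩ : ∃ T', (T' = T ∨ T' = Tᶜ) ∧ (s i).1 ∈ T' ∧
        (M'.cut T').ncard < 3 ∧ (s (i + 1)).1 ∉ T' ∧ (s (i + 2)).1 ∉ T' := by
      by_cases hiT : (s i).1 ∈ T
      · exact ⟨T, Or.inl rfl, hiT, hcut, by simp [ha, hiT], by simp [hb, hiT]⟩
      · exact ⟨Tᶜ, Or.inr rfl, hiT, by rwa [cut_compl_ncard], by simp [ha, hiT],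
          by simp [hb, hiT]⟩
    have hcut' : ∀ d ∈ M'.cut T', d = rot (s i) 2 ∨ d = rot (s i) 3 := fun d hd =>
      eq_or_eq_of_ncard_lt_three hT'cut (a := rot (s i) 2) (b := rot (s i) 3)
        ⟨hiT', by rw [hs.side]; exact haT'⟩ ⟨hiT', by rw [hside]; exact hbT'⟩
        (by rw [Ne, rot_inj]; decide) hd
    have hcutin : ∀ d ∈ M'.cut T', d.1 ∈ (Set.range fun i => (s i).1) ∧
        (M'.edge d).1 ∈ Set.range fun i => (s i).1 := by
      intro d hd
      rcases hcut' d hd with rfl | rfl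
      · exact ⟨⟨i, rfl⟩, ⟨i + 1, by rw [hs.side]; rfl⟩⟩
      · exact ⟨⟨i, rfl⟩, ⟨i + 2, by rw [hside]; rfl⟩⟩
    refine ⟨?_, T', hT', M'.edge (s i), M'.edge (rot (s i) 1), ⟨?_, ?_⟩, ?_⟩
    · rcases hT' with rfl | rfl
      · exact hcutin
      · rintro d ⟨hd1, hd2⟩
        have := hcutin (M'.edge d) ⟨hd2, by rw [M'.edge_edge]; simpa using hd1⟩
        rw [M'.edge_edge] at this
        exact this.symm
    · rintro ⟨j, hj⟩
      exact hs.left_out i j hj.symm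
    · rw [M'.edge_edge]
      exact ⟨⟨i, rfl⟩, hiT'⟩
    · rintro d hd ⟨⟨j, hj⟩, hdT⟩
      have hji : j = i := by
        by_contra hne
        have := eq_add_one_or_eq_add_two hne
        simp only at hj
        rw [← hj] at hdT
        rcases this with rfl | rfl
        · exact haT' hdT
        · exact hbT' hdT
      subst hji
      exact hs.eq_of_edge (fun i hi => hd ⟨i, hi.symm⟩) hj.symm

end QuarticMap

/-- Applying `ots` to a triangle of crossings of a diagram gives a diagram. -/
lemma Diagram.exists_otsMove [Finite V] (D : Diagram V) {t : Fin 3 → Dart V}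
    (ht : D.IsOtsTriangle t) : ∃ D' : Diagram V, IsOTSMove D D' ∧
      D.IsOts t D'.toQuarticMap fun i => rot (t i) 1 := by
  have h := ht.isOts_otsMap
  have h3 := h.threeEdgeConnected ht D.prime
  have : Nontrivial V := ⟨_, _, ht.injective.ne (show (0 : Fin 3) ≠ 1 by decide)⟩
  refine ⟨⟨D.otsMap t ht.injective, ?_, ?_, h3.not_isNugatoryAt, h3⟩, ⟨t, _, ht, h⟩, h⟩
  · rw [EulerPlanar, h.numFaces_eq ht]
    exact D.planar
  · exact h.alternating ht (fun i => by simp only [rot, even_add_one_zmod_four]) D.alternating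

end

/-! ### Subgroups as sequences of half-edges, and the operation T -/

section

variable {V U ι : Type*} {m : ℕ}

/-- The four half-edges at the ends of a sequence of half-edges. -/
def tip (c : Fin (m + 1) → Dart V) (k : ZMod 4) : Dart V :=
  if k = 0 ∨ k = 1 then rot (c 0) k else rot (c (Fin.last m)) k

@[simp] lemma tip_zero (c : Fin (m + 1) → Dart V) : tip c 0 = c 0 := by simp [tip]

@[simp] lemma tip_one (c : Fin (m + 1) → Dart V) : tip c 1 = rot (c 0) 1 := by simp [tip]

@[simp] lemma tip_two (c : Fin (m + 1) → Dart V) : tip c 2 = rot (c (Fin.last m)) 2 :=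
  if_neg (by decide)

@[simp] lemma tip_three (c : Fin (m + 1) → Dart V) : tip c 3 = rot (c (Fin.last m)) 3 :=
  if_neg (by decide)

lemma tip_fst (c : Fin (m + 1) → Dart V) (k : ZMod 4) : ∃ i, (tip c k).1 = (c i).1 := by
  unfold tip
  split_ifs
  · exact ⟨0, rfl⟩
  · exact ⟨Fin.last m, rfl⟩

/-- A half-edge at a vertex of the sequence is at one of the ends, or in between. -/
lemma rot_cases (c : Fin (m + 1) → Dart V) {p : Dart V → Prop} (h : ∀ k, p (tip c k))
    (h0 : ∀ i : Fin m, p (c i.succ)) (h1 : ∀ i : Fin m, p (rot (c i.succ) 1))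
    (h2 : ∀ i : Fin m, p (rot (c i.castSucc) 2)) (h3 : ∀ i : Fin m, p (rot (c i.castSucc) 3))
    (i : Fin (m + 1)) : ∀ k, p (rot (c i) k) := by
  refine forall_zmod_four ?_ ?_ ?_ ?_
  · rw [rot_zero]
    exact Fin.cases (by simpa using h 0) h0 i
  · exact Fin.cases (by simpa using h 1) h1 i
  · exact Fin.lastCases (by simpa using h 2) h2 i
  · exact Fin.lastCases (by simpa using h 3) h3 i

lemma exists_change (p : Fin (m + 1) → Prop) (h1 : ∃ i, p i) (h2 : ∃ i, ¬ p i) :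
    ∃ j : Fin m, ¬ (p j.castSucc ↔ p j.succ) := by
  by_contra hne
  push Not at hne
  have : ∀ i, p i ↔ p 0 := fun i => by
    induction i using Fin.induction with
    | zero => rfl
    | succ i ih => rw [← hne, ih]
  obtain ⟨i, hi⟩ := h1
  obtain ⟨j, hj⟩ := h2
  exact hj ((this j).2 ((this i).1 hi))

/-- Serves to show that a small cut running through one 2-gon of a subgroup separates its two ends.
-/
lemma iff_ends_of_unique_change (p : Fin (m + 1) → Prop) (j : Fin m)
    (h : ∀ i, i ≠ j → (p i.castSucc ↔ p i.succ)) :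
    (p 0 ↔ p j.castSucc) ∧ (p (Fin.last m) ↔ p j.succ) := by
  constructor
  · have : ∀ i : Fin (m + 1), i ≤ j.castSucc → (p 0 ↔ p i) := fun i => by
      induction i using Fin.induction with
      | zero => simp
      | succ i ih =>
        intro hi
        have hij : i < j := Fin.lt_def.2 (by
          have := Fin.le_def.1 hi
          simp only [Fin.val_succ, Fin.val_castSucc] at this
          omega)
        rw [← h i hij.ne]
        exact ih (by simpa using hij.le)
    exact this _ le_rfl
  · have : ∀ i : Fin (m + 1), j.succ ≤ i → (p (Fin.last m) ↔ p i) := fun i => by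
      induction i using Fin.reverseInduction with
      | last => simp
      | cast i ih =>
        intro hi
        have hij : j < i := Fin.lt_def.2 (by
          have := Fin.le_def.1 hi
          simp only [Fin.val_succ, Fin.val_castSucc] at this
          omega)
        rw [h i hij.ne']
        exact ih (by simpa using hij.le)
    exact this _ le_rfl

namespace QuarticMap

variable {M M' : QuarticMap V} {c c' : Fin (m + 1) → Dart V}

/-- A sequence of half-edges that describes a subgroup. -/
structure IsTwist (M : QuarticMap V) (c : Fin (m + 1) → Dart V) : Prop where
  injective : Function.Injective fun i => (c i).1
  edge_three : ∀ i : Fin m, M.edge (rot (c i.castSucc) 3) = c i.succ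
  edge_two : ∀ i : Fin m, M.edge (rot (c i.castSucc) 2) = rot (c i.succ) 1

namespace IsTwist

lemma edge_zero (h : M.IsTwist c) (i : Fin m) : M.edge (c i.succ) = rot (c i.castSucc) 3 :=
  edge_eq_comm.1 (h.edge_three i)

lemma edge_one (h : M.IsTwist c) (i : Fin m) :
    M.edge (rot (c i.succ) 1) = rot (c i.castSucc) 2 :=
  edge_eq_comm.1 (h.edge_two i)

lemma rot_inj (h : M.IsTwist c) {i j : Fin (m + 1)} {a b : ZMod 4}
    (hab : rot (c i) a = rot (c j) b) : i = j ∧ a = b := by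
  have := (cellEmb c h.injective).injective (a₁ := (i, a)) (a₂ := (j, b)) hab
  simpa using this

lemma sameCycle_zero (h : M.IsTwist c) (i : Fin (m + 1)) :
    M.facePerm.SameCycle (c i) (c 0) := by
  induction i using Fin.induction with
  | zero => exact Equiv.Perm.SameCycle.refl _ _
  | succ i ih =>
    refine Equiv.Perm.SameCycle.trans ?_ ih
    have := (M.sameCycle_facePerm (c i.succ)).symm
    rwa [facePerm_apply, h.edge_zero, rot_rot, show (3 : ZMod 4) + 1 = 0 by decide,
      rot_zero] at this

lemma sameCycle_two (h : M.IsTwist c) (i : Fin (m + 1)) :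
    M.facePerm.SameCycle (rot (c i) 2) (rot (c (Fin.last m)) 2) := by
  induction i using Fin.reverseInduction with
  | last => exact Equiv.Perm.SameCycle.refl _ _
  | cast i ih =>
    refine Equiv.Perm.SameCycle.trans ?_ ih
    have := (M.sameCycle_facePerm (rot (c i.castSucc) 2)).symm
    rwa [facePerm_apply, h.edge_two, rot_rot, show (1 : ZMod 4) + 1 = 2 by decide] at this

/-- Consecutive strands border a common face: at one end this is immediate, and along the sides the
face runs past all the crossings. -/
lemma sameCycle_tip (h : M.IsTwist c) :
    ∀ k, M.facePerm.SameCycle (rot (tip c k) 1) (tip c (k + 1)) := by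
  refine forall_zmod_four ?_ ?_ ?_ ?_
  · rw [zero_add, tip_zero, tip_one]
  · simp only [tip_one, rot_rot]
    rw [show (1 : ZMod 4) + 1 = 2 by decide, tip_two]
    exact h.sameCycle_two 0
  · simp only [tip_two, rot_rot]
    rw [show (2 : ZMod 4) + 1 = 3 by decide, tip_three]
  · simp only [tip_three, rot_rot]
    rw [show (3 : ZMod 4) + 1 = 0 by decide, tip_zero, rot_zero]
    exact h.sameCycle_zero _

lemma exists_edge_eq_tip (h : M.IsTwist c) {d : Dart V} (hd : ∀ i, d.1 ≠ (c i).1)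
    {i : Fin (m + 1)} (hi : (M.edge d).1 = (c i).1) : ∃ k, M.edge d = tip c k := by
  obtain ⟨k, hk⟩ := exists_eq_rot hi
  have hd' : M.edge (M.edge d) = d := M.edge_edge d
  rw [hk] at hd' ⊢
  revert hd'
  refine rot_cases c (p := fun x => M.edge x = d → ∃ k, x = tip c k) ?_ ?_ ?_ ?_ ?_ i k
  · exact fun k _ => ⟨k, rfl⟩
  · rintro i rfl
    rw [h.edge_zero] at hd
    exact absurd rfl (hd i.castSucc)
  · rintro i rfl
    rw [h.edge_one] at hd
    exact absurd rfl (hd i.castSucc)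
  · rintro i rfl
    rw [h.edge_two] at hd
    exact absurd rfl (hd i.succ)
  · rintro i rfl
    rw [h.edge_three] at hd
    exact absurd rfl (hd i.succ)

/-- The sequence read in the opposite direction. -/
lemma rev (h : M.IsTwist c) : M.IsTwist fun i => rot (c i.rev) 2 where
  injective := h.injective.comp Fin.rev_injective
  edge_three i := by
    rw [Fin.rev_castSucc, rot_rot, show (2 : ZMod 4) + 3 = 1 by decide, h.edge_one, Fin.rev_succ]
  edge_two i := by
    rw [Fin.rev_castSucc, rot_rot, show (2 : ZMod 4) + 2 = 0 by decide, rot_zero, h.edge_zero,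
      rot_rot, Fin.rev_succ]
    rfl

end IsTwist

lemma tip_rev (c : Fin (m + 1) → Dart V) :
    ∀ k, tip (fun i => rot (c i.rev) 2) k = tip c (k + 2) := by
  refine forall_zmod_four ?_ ?_ ?_ ?_
  · simp
  · rw [show (1 : ZMod 4) + 2 = 3 by decide]
    simp [show (2 : ZMod 4) + 1 = 3 by decide]
  · rw [show (2 : ZMod 4) + 2 = 0 by decide]
    simp [show (2 : ZMod 4) + 2 = 0 by decide]
  · rw [show (3 : ZMod 4) + 2 = 1 by decide]
    simp [show (2 : ZMod 4) + 3 = 1 by decide]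

/-- `M'` arises from `M` when the subgroup described by `c` is turned and becomes `c'`. -/
structure IsTurnOf (M : QuarticMap V) (c : Fin (m + 1) → Dart V) (M' : QuarticMap V)
    (c' : Fin (m + 1) → Dart V) : Prop where
  twist : M.IsTwist c
  twist' : M'.IsTwist c'
  vertices : (Set.range fun i => (c' i).1) = Set.range fun i => (c i).1
  out : ∀ k i, (M.edge (tip c k)).1 ≠ (c i).1
  edge_tip : ∀ k, M'.edge (tip c' k) = M.edge (tip c (k + 1))
  agreeOff : AgreeOff (Set.range fun i => (c i).1) M M'

namespace IsTurnOf

lemma ne (h : M.IsTurnOf c M' c') {v : V} : (∀ i, v ≠ (c' i).1) ↔ ∀ i, v ≠ (c i).1 := by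
  have : (v ∉ Set.range fun i => (c' i).1) ↔ v ∉ Set.range fun i => (c i).1 := by
    rw [h.vertices]
  simpa [eq_comm] using this

lemma outside (h : M.IsTurnOf c M' c') {d : Dart V} (h1 : ∀ i, d.1 ≠ (c i).1)
    (h2 : ∀ i, (M.edge d).1 ≠ (c i).1) : M'.edge d = M.edge d :=
  h.agreeOff d (by rintro ⟨i, hi⟩; exact h1 i hi.symm) (by rintro ⟨i, hi⟩; exact h2 i hi.symm)

lemma exists_edge_eq (h : M.IsTurnOf c M' c') {d : Dart V} (hd : ∀ i, d.1 ≠ (c i).1)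
    {i : Fin (m + 1)} (hi : (M.edge d).1 = (c i).1) :
    ∃ k, M.edge d = tip c (k + 1) ∧ M'.edge d = tip c' k := by
  obtain ⟨k, hk⟩ := h.twist.exists_edge_eq_tip hd hi
  refine ⟨k - 1, by rw [sub_add_cancel, hk], ?_⟩
  rw [edge_eq_comm, h.edge_tip, sub_add_cancel, ← hk, M.edge_edge]

/-- Turning twice is a half turn, which only reverses the reading direction of the subgroup; hence
turning back is again a turn. -/
lemma symm (h : M.IsTurnOf c M' c') : M'.IsTurnOf c' M fun i => rot (c i.rev) 2 where
  twist := h.twist'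
  twist' := h.twist.rev
  vertices := by
    rw [h.vertices]
    exact (Fin.rev_surjective).range_comp (fun i => (c i).1)
  out k i := by
    rw [h.edge_tip]
    exact (h.ne.2 (h.out _)) i
  edge_tip k := by
    rw [tip_rev, h.edge_tip, add_assoc]
    rfl
  agreeOff d h1 h2 := by
    have h1' : ∀ i, d.1 ≠ (c i).1 := h.ne.1 fun i hi => h1 ⟨i, hi.symm⟩
    by_cases h3 : ∀ i, (M.edge d).1 ≠ (c i).1
    · exact (h.outside h1' h3).symm
    · push Not at h3
      obtain ⟨i, hi⟩ := h3
      obtain ⟨k, -, hk⟩ := h.exists_edge_eq h1' hi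
      obtain ⟨j, hj⟩ := tip_fst c' k
      exact absurd ⟨j, by rw [hk, hj]⟩ h2

lemma numFaces_le [Finite V] (h : M.IsTurnOf c M' c') : M'.numFaces ≤ M.numFaces := by
  have hc := h.twist
  have hc' := h.twist'
  -- The 2-gon between crossings i and i + 1 has the half-edges of index 3 at i and index 1 at i +
  -- 1, and goes to the new 2-gon there. The remaining half-edges lie on the four faces around the
  -- subgroup; each goes to a tip on the same face after the turn.
  let val : Fin (m + 1) × ZMod 4 → Dart V := fun p => match p with
    | (_, 0) => tip c' 3
    | (i, 1) => Fin.cases (motive := fun _ => Dart V) (tip c' 0) (fun j => rot (c' j.succ) 1) i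
    | (_, 2) => tip c' 1
    | (i, 3) => Fin.lastCases (motive := fun _ => Dart V) (tip c' 2)
        (fun j => rot (c' j.castSucc) 3) i
  let α : Dart V → Dart V := Function.extend (cellEmb c hc.injective) val id
  have hα : ∀ i k, α (rot (c i) k) = val (i, k) := fun i k =>
    (cellEmb c hc.injective).injective.extend_apply val id (i, k)
  have hα0 : ∀ i, α (c i) = tip c' 3 := fun i => by
    have := hα i 0
    rwa [rot_zero] at this
  have hα1z : α (rot (c 0) 1) = tip c' 0 := hα 0 1
  have hα1 : ∀ i : Fin m, α (rot (c i.succ) 1) = rot (c' i.succ) 1 := fun i => hα i.succ 1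
  have hα2 : ∀ i, α (rot (c i) 2) = tip c' 1 := fun i => hα i 2
  have hα3l : α (rot (c (Fin.last m)) 3) = tip c' 2 := by
    refine (hα _ 3).trans ?_
    exact Fin.lastCases_last
  have hα3 : ∀ i : Fin m, α (rot (c i.castSucc) 3) = rot (c' i.castSucc) 3 := fun i => by
    refine (hα _ 3).trans ?_
    exact Fin.lastCases_castSucc i
  have hαtip : ∀ k, α (tip c (k + 1)) = tip c' k := by
    refine forall_zmod_four ?_ ?_ ?_ ?_
    · rw [zero_add, tip_one, hα1z]
    · rw [show (1 : ZMod 4) + 1 = 2 by decide, tip_two, hα2]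
    · rw [show (2 : ZMod 4) + 1 = 3 by decide, tip_three, hα3l]
    · rw [show (3 : ZMod 4) + 1 = 0 by decide, tip_zero, hα0]
  have hαtip' : ∀ k, α (rot (tip c k) 1) = tip c' k := by
    refine forall_zmod_four ?_ ?_ ?_ ?_
    · rw [tip_zero, hα1z]
    · rw [tip_one, rot_rot, show (1 : ZMod 4) + 1 = 2 by decide, hα2]
    · rw [tip_two, rot_rot, show (2 : ZMod 4) + 1 = 3 by decide, hα3l]
    · rw [tip_three, rot_rot, show (3 : ZMod 4) + 1 = 0 by decide, rot_zero, hα0]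
  have hαo : ∀ d : Dart V, (∀ i, d.1 ≠ (c i).1) → α d = d := fun d hd =>
    Function.extend_apply' _ _ _ (notMem_range_cellEmb hd)
  have hstep : ∀ {x y : Dart V}, rot (M'.edge x) 1 = y → M'.facePerm.SameCycle y x := by
    rintro x y rfl
    exact sameCycle_facePerm x
  apply QuarticMap.numFaces_le α
  · intro d
    rw [facePerm_apply]
    by_cases hd : ∀ i, d.1 ≠ (c i).1
    · rw [hαo d hd]
      by_cases hd' : ∀ i, (M.edge d).1 ≠ (c i).1
      · rw [hαo (rot _ 1) hd']
        exact hstep (by rw [h.outside hd hd'])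
      · push Not at hd'
        obtain ⟨i, hi⟩ := hd'
        obtain ⟨k, hk, hk'⟩ := h.exists_edge_eq hd hi
        rw [hk, hαtip']
        exact (hc'.sameCycle_tip k).symm.trans (hstep (by rw [hk']))
    · push Not at hd
      obtain ⟨i, hi⟩ := hd
      obtain ⟨k, rfl⟩ := exists_eq_rot hi
      refine rot_cases c
        (p := fun x => M'.facePerm.SameCycle (α (rot (M.edge x) 1)) (α x)) ?_ ?_ ?_ ?_ ?_ i k
      · intro k
        obtain ⟨k, rfl⟩ : ∃ j, k = j + 1 := ⟨k - 1, by simp⟩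
        rw [hαtip, hαo (rot _ 1) (h.out _)]
        exact hstep (by rw [h.edge_tip])
      · intro i
        rw [hc.edge_zero, rot_rot, show (3 : ZMod 4) + 1 = 0 by decide, rot_zero, hα0, hα0]
      · intro i
        rw [hc.edge_one, rot_rot, show (2 : ZMod 4) + 1 = 3 by decide, hα3, hα1]
        exact (hstep (by rw [hc'.edge_three])).symm
      · intro i
        rw [hc.edge_two, rot_rot, show (1 : ZMod 4) + 1 = 2 by decide, hα2, hα2]
      · intro i
        rw [hc.edge_three, hα1, hα3]
        exact hstep (by rw [hc'.edge_three])
  · intro y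
    by_cases hy : ∀ i, y.1 ≠ (c' i).1
    · exact ⟨y, by rw [hαo y (h.ne.1 hy)]⟩
    · push Not at hy
      obtain ⟨i, hi⟩ := hy
      obtain ⟨k, rfl⟩ := exists_eq_rot hi
      refine rot_cases c' (p := fun y => ∃ x, M'.facePerm.SameCycle (α x) y) ?_ ?_ ?_ ?_ ?_ i k
      · exact fun k => ⟨_, by rw [hαtip]⟩
      · exact fun i => ⟨tip c (0 + 1), by
          rw [hαtip, tip_zero]; exact (hc'.sameCycle_zero _).symm⟩
      · exact fun i => ⟨_, by rw [hα1]⟩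
      · exact fun i => ⟨tip c (2 + 1), by
          rw [hαtip, tip_two]; exact (hc'.sameCycle_two _).symm⟩
      · exact fun i => ⟨_, by rw [hα3]⟩

lemma numFaces_eq [Finite V] (h : M.IsTurnOf c M' c') : M'.numFaces = M.numFaces :=
  le_antisymm h.numFaces_le h.symm.numFaces_le

lemma alternating (h : M.IsTurnOf c M' c') (hpar : ∀ i, Even (c' i).2 ↔ ¬ Even (c i).2)
    (halt : ∀ d, Even (M.edge d).2 ↔ ¬ Even d.2) (d : Dart V) :
    Even (M'.edge d).2 ↔ ¬ Even d.2 := by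
  have hcc : ∀ i, Even (c i).2 ↔ Even (c 0).2 := fun i => by
    induction i using Fin.induction with
    | zero => rfl
    | succ i ih =>
      rw [← ih]
      have := halt (rot (c i.castSucc) 3)
      rw [h.twist.edge_three] at this
      simp only [rot, even_add_three_zmod_four] at this
      tauto
  have htip : ∀ k, Even (tip c (k + 1)).2 ↔ Even (tip c' k).2 := by
    refine forall_zmod_four ?_ ?_ ?_ ?_
    · simp only [zero_add, tip_one, tip_zero, rot, even_add_one_zmod_four, hpar]
    · rw [show (1 : ZMod 4) + 1 = 2 by decide]
      simp only [tip_two, tip_one, rot, even_add_one_zmod_four, even_add_two_zmod_four, hpar,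
        hcc (Fin.last m), not_not]
    · rw [show (2 : ZMod 4) + 1 = 3 by decide]
      simp only [tip_two, tip_three, rot, even_add_three_zmod_four, even_add_two_zmod_four, hpar,
        hcc (Fin.last m)]
    · rw [show (3 : ZMod 4) + 1 = 0 by decide]
      simp only [tip_zero, tip_three, rot, even_add_three_zmod_four, hpar, hcc (Fin.last m),
        not_not]
  have hin : ∀ i k, Even (M'.edge (rot (c' i) k)).2 ↔ ¬ Even (rot (c' i) k).2 := by
    refine rot_cases c' (p := fun x => Even (M'.edge x).2 ↔ ¬ Even x.2) ?_ ?_ ?_ ?_ ?_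
    · intro k
      rw [h.edge_tip, halt, htip]
    · intro i
      rw [h.twist'.edge_zero]
      simp only [rot, even_add_three_zmod_four, hpar, hcc]
    · intro i
      rw [h.twist'.edge_one]
      simp only [rot, even_add_two_zmod_four, even_add_one_zmod_four, hpar, hcc, not_not]
    · intro i
      rw [h.twist'.edge_two]
      simp only [rot, even_add_two_zmod_four, even_add_one_zmod_four, hpar, hcc]
    · intro i
      rw [h.twist'.edge_three]
      simp only [rot, even_add_three_zmod_four, hpar, hcc, not_not]
  by_cases hd : ∀ i, d.1 ≠ (c' i).1
  · by_cases hd' : ∀ i, (M'.edge d).1 ≠ (c' i).1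
    · rw [← h.symm.outside hd hd', halt]
    · push Not at hd'
      obtain ⟨i, hi⟩ := hd'
      obtain ⟨k, hk⟩ := exists_eq_rot hi
      have := hin i k
      rw [← hk, M'.edge_edge] at this
      tauto
  · push Not at hd
    obtain ⟨i, hi⟩ := hd
    obtain ⟨k, rfl⟩ := exists_eq_rot hi
    exact hin i k

/-- A cut that splits the subgroup runs through one of its 2-gons and contains both sides of it. If
the cut is small there is nothing else in it, so one side of the cut meets only the two strands at
one end. -/
lemma threeEdgeConnected [Finite V] (h : M.IsTurnOf c M' c') (h3 : M.ThreeEdgeConnected) :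
    M'.ThreeEdgeConnected := by
  have hc' := h.twist'
  refine h3.of_agreeOff h.agreeOff ?_ ?_
  · rintro d hd ⟨i, hi⟩
    obtain ⟨k, -, hk⟩ := h.exists_edge_eq (fun i hi => hd ⟨i, hi.symm⟩) hi.symm
    obtain ⟨j, hj⟩ := tip_fst c' k
    exact h.vertices ▸ ⟨j, by rw [hk, hj]⟩
  · rw [← h.vertices]
    rintro T ⟨_, ⟨i1, rfl⟩, hi1⟩ ⟨_, ⟨i2, rfl⟩, hi2⟩ hcut
    obtain ⟨j, hj⟩ := exists_change (fun i => (c' i).1 ∈ T) ⟨i1, hi1⟩ ⟨i2, hi2⟩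
    obtain ⟨T', hT', hjT', hT'cut, hsT'⟩ : ∃ T', (T' = T ∨ T' = Tᶜ) ∧
        (c' j.castSucc).1 ∈ T' ∧ (M'.cut T').ncard < 3 ∧ (c' j.succ).1 ∉ T' := by
      by_cases hjT : (c' j.castSucc).1 ∈ T
      · exact ⟨T, Or.inl rfl, hjT, hcut, by tauto⟩
      · exact ⟨Tᶜ, Or.inr rfl, hjT, by rwa [cut_compl_ncard], by
          simp only [Set.mem_compl_iff]; tauto⟩
    have hcut' : ∀ d ∈ M'.cut T', d = rot (c' j.castSucc) 2 ∨ d = rot (c' j.castSucc) 3 :=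
      fun d hd => eq_or_eq_of_ncard_lt_three hT'cut
        (a := rot (c' j.castSucc) 2) (b := rot (c' j.castSucc) 3)
        ⟨hjT', by rw [hc'.edge_two]; exact hsT'⟩ ⟨hjT', by rw [hc'.edge_three]; exact hsT'⟩
        (by rw [Ne, AlternatingDiagrams.rot_inj]; decide) hd
    have hcutin : ∀ d ∈ M'.cut T', d.1 ∈ (Set.range fun i => (c' i).1) ∧
        (M'.edge d).1 ∈ Set.range fun i => (c' i).1 := by
      intro d hd
      rcases hcut' d hd with rfl | rfl
      · exact ⟨⟨j.castSucc, rfl⟩, ⟨j.succ, by rw [hc'.edge_two]; rfl⟩⟩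
      · exact ⟨⟨j.castSucc, rfl⟩, ⟨j.succ, by rw [hc'.edge_three]⟩⟩
    obtain ⟨h0, hlast⟩ := iff_ends_of_unique_change (fun i => (c' i).1 ∈ T') j (by
      intro i hij
      constructor
      · intro h1
        by_contra h2
        have hmem : rot (c' i.castSucc) 2 ∈ M'.cut T' := ⟨h1, by rw [hc'.edge_two]; exact h2⟩
        rcases hcut' _ hmem with h | h <;>
        exact hij (Fin.castSucc_injective _ (hc'.rot_inj h).1)
      · intro h1
        by_contra h2
        have hmem : rot (c' i.succ) 0 ∈ M'.cut T' :=
          ⟨h1, by rw [rot_zero, hc'.edge_zero]; exact h2⟩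
        rcases hcut' _ hmem with h | h <;>
        exact absurd (hc'.rot_inj h).2 (by decide))
    have h0T : (c' 0).1 ∈ T' := h0.2 hjT'
    have hlT : (c' (Fin.last m)).1 ∉ T' := fun h => hsT' (hlast.1 h)
    have hout : ∀ k, (M'.edge (tip c' k)).1 ∉ Set.range fun i => (c' i).1 := by
      rintro k ⟨i, hi⟩
      exact h.symm.out k i hi.symm
    refine ⟨?_, T', hT', M'.edge (tip c' 0), M'.edge (tip c' 1), ⟨hout 0, ?_⟩, ?_⟩
    · rcases hT' with rfl | rfl
      · exact hcutin
      · rintro d ⟨hd1, hd2⟩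
        have := hcutin (M'.edge d) ⟨hd2, by rw [M'.edge_edge]; simpa using hd1⟩
        rw [M'.edge_edge] at this
        exact this.symm
    · rw [M'.edge_edge, tip_zero]
      exact ⟨⟨0, rfl⟩, h0T⟩
    · rintro d hd ⟨⟨i, hi⟩, hdT⟩
      obtain ⟨k, hk⟩ := hc'.exists_edge_eq_tip (fun i hi => hd ⟨i, hi.symm⟩) hi.symm
      rw [hk] at hdT
      rw [← M'.edge_edge d, hk]
      clear hi hk
      revert k
      refine forall_zmod_four ?_ ?_ ?_ ?_
      · simp
      · simp
      · intro h; rw [tip_two] at h; exact absurd h hlT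
      · intro h; rw [tip_three] at h; exact absurd h hlT

end IsTurnOf

/-- The permutation of the half-edges of a subgroup behind the operation `T`. -/
def turnPerm (m : ℕ) : Equiv.Perm (Fin (m + 1) × ZMod 4) where
  -- Again from new half-edges to old ones, the new sequence being `rot (c i) 1`: the strand k of
  -- the turned subgroup goes to the old strand k + 1, and the 2-gons between crossings go to the
  -- same 2-gons.
  toFun p := match p with
    | (i, 0) => Fin.lastCases (motive := fun _ => Fin (m + 1) × ZMod 4) (0, 0)
        (fun j => (j.castSucc, 3)) i
    | (i, 1) => Fin.cases (motive := fun _ => Fin (m + 1) × ZMod 4) (0, 1)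
        (fun j => (j.succ, 0)) i
    | (i, 2) => Fin.cases (motive := fun _ => Fin (m + 1) × ZMod 4) (Fin.last m, 2)
        (fun j => (j.succ, 1)) i
    | (i, 3) => Fin.lastCases (motive := fun _ => Fin (m + 1) × ZMod 4) (Fin.last m, 3)
        (fun j => (j.castSucc, 2)) i
  invFun p := match p with
    | (i, 0) => Fin.cases (motive := fun _ => Fin (m + 1) × ZMod 4) (Fin.last m, 0)
        (fun j => (j.succ, 1)) i
    | (i, 1) => Fin.cases (motive := fun _ => Fin (m + 1) × ZMod 4) (0, 1)
        (fun j => (j.succ, 2)) i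
    | (i, 2) => Fin.lastCases (motive := fun _ => Fin (m + 1) × ZMod 4) (0, 2)
        (fun j => (j.castSucc, 3)) i
    | (i, 3) => Fin.lastCases (motive := fun _ => Fin (m + 1) × ZMod 4) (Fin.last m, 3)
        (fun j => (j.castSucc, 0)) i
  left_inv := by
    rintro ⟨i, k⟩
    revert k
    refine forall_zmod_four ?_ ?_ ?_ ?_
    · refine Fin.lastCases ?_ (fun j => ?_) i <;> simp
    · refine Fin.cases ?_ (fun j => ?_) i <;> simp
    · refine Fin.cases ?_ (fun j => ?_) i <;> simp
    · refine Fin.lastCases ?_ (fun j => ?_) i <;> simp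
  right_inv := by
    rintro ⟨i, k⟩
    revert k
    refine forall_zmod_four ?_ ?_ ?_ ?_
    · refine Fin.cases ?_ (fun j => ?_) i <;> simp
    · refine Fin.cases ?_ (fun j => ?_) i <;> simp
    · refine Fin.lastCases ?_ (fun j => ?_) i <;> simp
    · refine Fin.lastCases ?_ (fun j => ?_) i <;> simp

/-- The map obtained by turning a subgroup. -/
noncomputable def turnMap (M : QuarticMap V) (c : Fin (m + 1) → Dart V)
    (hc : Function.Injective fun i => (c i).1) : QuarticMap V :=
  M.rewire c hc (turnPerm m)

lemma IsTwist.isTurnOf_turnMap (hc : M.IsTwist c) (hout : ∀ k i, (M.edge (tip c k)).1 ≠ (c i).1) :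
    M.IsTurnOf c (M.turnMap c hc.injective) fun i => rot (c i) 1 where
  twist := hc
  twist' :=
    { injective := hc.injective
      edge_three := fun i => by
        apply rewire_edge_of_eq
        rw [rot_rot, show (1 : ZMod 4) + 3 = 0 by decide, viaEmbedding_cell, viaEmbedding_cell]
        simp [turnPerm, hc.edge_three]
      edge_two := fun i => by
        apply rewire_edge_of_eq
        rw [rot_rot, rot_rot, show (1 : ZMod 4) + 2 = 3 by decide,
          show (1 : ZMod 4) + 1 = 2 by decide, viaEmbedding_cell, viaEmbedding_cell]
        simp [turnPerm, hc.edge_two] }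
  vertices := rfl
  out := hout
  edge_tip := by
    have htip : ∀ k, (turnPerm m).viaEmbedding (cellEmb c hc.injective)
        (tip (fun i => rot (c i) 1) k) = tip c (k + 1) := by
      refine forall_zmod_four ?_ ?_ ?_ ?_
      · rw [tip_zero, viaEmbedding_cell]
        simp [turnPerm]
      · rw [tip_one, rot_rot, show (1 : ZMod 4) + 1 = 2 by decide, viaEmbedding_cell]
        simp [turnPerm]
      · rw [tip_two, rot_rot, show (2 : ZMod 4) + 1 = 3 by decide,
          show (1 : ZMod 4) + 2 = 3 by decide, viaEmbedding_cell]
        simp [turnPerm]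
      · rw [tip_three, rot_rot, show (3 : ZMod 4) + 1 = 0 by decide,
          show (1 : ZMod 4) + 3 = 0 by decide, viaEmbedding_cell]
        simp [turnPerm]
    intro k
    apply rewire_edge_of_eq
    rw [htip, viaEmbedding_of_ne _ (hout (k + 1))]
  agreeOff := fun d h1 h2 => rewire_edge_of_ne (fun i hi => h1 ⟨i, hi.symm⟩)
    fun i hi => h2 ⟨i, hi.symm⟩

end QuarticMap

end

/-! ### Subgroups: reversal, joining, splitting, and turning inside a diagram -/

section

variable {V U ι : Type*} {m : ℕ}

namespace QuarticMap

variable {M M' : QuarticMap V}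

namespace Subgroup

variable (r : M.Subgroup)

@[simp] lemma strand_zero : r.strand 0 = r.darts.head r.ne_nil := by simp [strand]

@[simp] lemma strand_one : r.strand 1 = rot (r.darts.head r.ne_nil) 1 := by simp [strand]

@[simp] lemma strand_two : r.strand 2 = rot (r.darts.getLast r.ne_nil) 2 := if_neg (by decide)

@[simp] lemma strand_three : r.strand 3 = rot (r.darts.getLast r.ne_nil) 3 := if_neg (by decide)

lemma strand_mem (k : ZMod 4) : (r.strand k).1 ∈ r.vertices := by
  unfold strand
  split_ifs
  · exact ⟨_, List.head_mem _, rfl⟩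
  · exact ⟨_, List.getLast_mem _, rfl⟩

lemma size_pos : 0 < r.size := List.length_pos_iff.2 r.ne_nil

lemma strand_congr {r : M.Subgroup} {r' : M'.Subgroup} (h : r'.darts = r.darts) (k : ZMod 4) :
    r'.strand k = r.strand k := by
  simp only [strand, h]

lemma vertices_congr {r : M.Subgroup} {r' : M'.Subgroup} (h : r'.darts = r.darts) :
    r'.vertices = r.vertices := by
  simp only [vertices, h]

lemma size_congr {r : M.Subgroup} {r' : M'.Subgroup} (h : r'.darts = r.darts) :
    r'.size = r.size := by
  simp only [size, h]

/-- A subgroup is a subgroup of every map with the same edges between its vertices. -/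
def transfer (h : ∀ d, d.1 ∈ r.vertices → (M.edge d).1 ∈ r.vertices → M'.edge d = M.edge d) :
    M'.Subgroup where
  darts := r.darts
  ne_nil := r.ne_nil
  nodup := r.nodup
  chain := by
    have hc := r.chain
    rw [List.isChain_iff_getElem] at hc ⊢
    intro i hi
    obtain ⟨h3, h2⟩ := hc i hi
    have hm : ∀ (j : ℕ) (hj : j < r.darts.length), (r.darts[j]).1 ∈ r.vertices := fun j hj =>
      ⟨_, List.getElem_mem hj, rfl⟩
    rw [h (rot _ 3) (hm i _) (by rw [h3]; exact hm _ _),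
      h (rot _ 2) (hm i _) (by rw [h2]; exact hm _ _)]
    exact ⟨h3, h2⟩

/-- A subgroup outside of the changed part of a map. -/
def transferOff {S : Set V} (h : AgreeOff S M M') (hr : Disjoint r.vertices S) : M'.Subgroup :=
  r.transfer fun d h1 h2 => h d (Set.disjoint_left.1 hr h1) (Set.disjoint_left.1 hr h2)

/-- The subgroup given by a sequence of half-edges. -/
def ofTwist {c : Fin (m + 1) → Dart V} (hc : M.IsTwist c) : M.Subgroup where
  darts := List.ofFn c
  ne_nil := by simp
  nodup := by
    rw [List.map_ofFn, List.nodup_ofFn]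
    exact hc.injective
  chain := by
    rw [List.isChain_ofFn]
    intro i hi
    have hi' : i < m := by omega
    exact ⟨hc.edge_three ⟨i, hi'⟩, hc.edge_two ⟨i, hi'⟩⟩

lemma strand_ofTwist {c : Fin (m + 1) → Dart V} (hc : M.IsTwist c) (k : ZMod 4) :
    (ofTwist hc).strand k = tip c k := by
  simp only [strand, tip, ofTwist, List.head_ofFn, List.getLast_ofFn]
  rfl

lemma vertices_ofTwist {c : Fin (m + 1) → Dart V} (hc : M.IsTwist c) :
    (ofTwist hc).vertices = Set.range fun i => (c i).1 := by
  ext v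
  simp only [vertices, ofTwist, List.mem_ofFn, Set.mem_ofPred_eq, Set.mem_range,
    exists_exists_eq_and]

lemma size_ofTwist {c : Fin (m + 1) → Dart V} (hc : M.IsTwist c) :
    (ofTwist hc).size = m + 1 := by
  simp [size, ofTwist]

lemma exists_eq_ofTwist : ∃ (m : ℕ) (c : Fin (m + 1) → Dart V) (hc : M.IsTwist c),
    r = ofTwist hc := by
  rcases r with ⟨l, h1, h2, h3⟩
  obtain ⟨m, hm⟩ : ∃ m, l.length = m + 1 :=
    ⟨l.length - 1, by have := List.length_pos_iff.2 h1; omega⟩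
  have key : ∀ n (c : Fin n → Dart V), l = List.ofFn c → n = m + 1 →
      ∃ c : Fin (m + 1) → Dart V, l = List.ofFn c := by
    rintro n c hc rfl
    exact ⟨c, hc⟩
  obtain ⟨c, rfl⟩ := key _ l.get (List.ofFn_get l).symm hm
  rw [List.map_ofFn, List.nodup_ofFn] at h2
  have h3' := h3
  rw [List.isChain_ofFn] at h3'
  have hc : M.IsTwist c := ⟨h2, fun i => (h3' i (by omega)).1, fun i => (h3' i (by omega)).2⟩
  exact ⟨m, c, hc, rfl⟩

/-- The subgroup read in the opposite direction. -/
lemma exists_reverse : ∃ r' : M.Subgroup, r'.vertices = r.vertices ∧ r'.size = r.size ∧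
    ∀ k, r'.strand k = r.strand (k + 2) := by
  obtain ⟨m, c, hc, rfl⟩ := r.exists_eq_ofTwist
  refine ⟨ofTwist hc.rev, ?_, ?_, fun k => ?_⟩
  · rw [vertices_ofTwist, vertices_ofTwist]
    exact (Fin.rev_surjective).range_comp (fun i => (c i).1)
  · rw [size_ofTwist, size_ofTwist]
  · rw [strand_ofTwist, strand_ofTwist, tip_rev]

/-- Two subgroups that are joined by a 2-gon at their ends. -/
def append (r₁ r₂ : M.Subgroup) (hd : Disjoint r₁.vertices r₂.vertices)
    (h3 : M.edge (r₁.strand 3) = r₂.strand 0) (h2 : M.edge (r₁.strand 2) = r₂.strand 1) :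
    M.Subgroup where
  darts := r₁.darts ++ r₂.darts
  ne_nil := by simp [r₁.ne_nil]
  nodup := by
    rw [List.map_append, List.nodup_append']
    refine ⟨r₁.nodup, r₂.nodup, ?_⟩
    intro v hv1 hv2
    rw [List.mem_map] at hv1 hv2
    exact Set.disjoint_left.1 hd hv1 hv2
  chain := by
    rw [List.isChain_append]
    refine ⟨r₁.chain, r₂.chain, ?_⟩
    intro x hx y hy
    rw [List.getLast?_eq_some_getLast r₁.ne_nil] at hx
    rw [List.head?_eq_some_head r₂.ne_nil] at hy
    obtain rfl : _ = x := by simpa using hx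
    obtain rfl : _ = y := by simpa using hy
    rw [strand_three, strand_zero] at h3
    rw [strand_two, strand_one] at h2
    exact ⟨h3, h2⟩

section append

variable {r₁ r₂ : M.Subgroup} (hd : Disjoint r₁.vertices r₂.vertices)
    (h3 : M.edge (r₁.strand 3) = r₂.strand 0) (h2 : M.edge (r₁.strand 2) = r₂.strand 1)

lemma append_strand_zero : (append r₁ r₂ hd h3 h2).strand 0 = r₁.strand 0 := by
  simp [append, List.head_append_of_ne_nil, r₁.ne_nil]

lemma append_strand_one : (append r₁ r₂ hd h3 h2).strand 1 = r₁.strand 1 := by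
  simp [append, List.head_append_of_ne_nil, r₁.ne_nil]

lemma append_strand_two : (append r₁ r₂ hd h3 h2).strand 2 = r₂.strand 2 := by
  simp [append, List.getLast_append_of_ne_nil, r₂.ne_nil]

lemma append_strand_three : (append r₁ r₂ hd h3 h2).strand 3 = r₂.strand 3 := by
  simp [append, List.getLast_append_of_ne_nil, r₂.ne_nil]

lemma append_vertices : (append r₁ r₂ hd h3 h2).vertices = r₁.vertices ∪ r₂.vertices := by
  ext v
  simp only [vertices, append, List.mem_append, Set.mem_ofPred_eq, Set.mem_union]
  constructor
  · rintro ⟨d, hd | hd, rfl⟩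
    · exact Or.inl ⟨d, hd, rfl⟩
    · exact Or.inr ⟨d, hd, rfl⟩
  · rintro (⟨d, hd, rfl⟩ | ⟨d, hd, rfl⟩)
    · exact ⟨d, Or.inl hd, rfl⟩
    · exact ⟨d, Or.inr hd, rfl⟩

lemma append_size : (append r₁ r₂ hd h3 h2).size = r₁.size + r₂.size := by
  simp [size, append]

end append

lemma exists_split {l k : ℕ} (hl : 0 < l) (hk : 0 < k) (h : r.size = l + k) :
    ∃ (r₁ r₂ : M.Subgroup) (hd : Disjoint r₁.vertices r₂.vertices)
      (h3 : M.edge (r₁.strand 3) = r₂.strand 0) (h2 : M.edge (r₁.strand 2) = r₂.strand 1),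
      r = append r₁ r₂ hd h3 h2 ∧ r₁.size = l ∧ r₂.size = k := by
  rcases r with ⟨L, hL, hnd, hc⟩
  change L.length = l + k at h
  obtain ⟨A, B, rfl, hA, hB⟩ : ∃ A B, L = A ++ B ∧ A.length = l ∧ B.length = k :=
    ⟨L.take l, L.drop l, (List.take_append_drop l L).symm, by simp [h], by simp [h]⟩
  have hA0 : A ≠ [] := List.length_pos_iff.1 (by omega)
  have hB0 : B ≠ [] := List.length_pos_iff.1 (by omega)
  have hnd' := hnd
  rw [List.map_append, List.nodup_append'] at hnd'
  have hc' := hc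
  rw [List.isChain_append] at hc'
  have hlast := hc'.2.2 (A.getLast hA0) (by simp [List.getLast?_eq_some_getLast hA0])
    (B.head hB0) (by simp [List.head?_eq_some_head hB0])
  refine ⟨⟨A, hA0, hnd'.1, hc'.1⟩, ⟨B, hB0, hnd'.2.1, hc'.2.1⟩, ?_, ?_, ?_, rfl, hA, hB⟩
  · rw [Set.disjoint_left]
    intro v hv1 hv2
    exact hnd'.2.2 (List.mem_map.2 hv1) (List.mem_map.2 hv2)
  · simpa using hlast.1
  · simpa using hlast.2

/-- The subgroup with a single vertex. -/
def single (d : Dart V) : M.Subgroup where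
  darts := [d]
  ne_nil := by simp
  nodup := by simp
  chain := by simp

lemma single_strand (d : Dart V) (k : ZMod 4) : (single d : M.Subgroup).strand k = rot d k := by
  simp [strand, single]

lemma single_vertices (d : Dart V) : (single d : M.Subgroup).vertices = {d.1} := by
  ext v
  simp [vertices, single, eq_comm]

lemma exists_eq_single (h : r.size = 1) : ∃ d, r = single d := by
  rcases r with ⟨L, hL, hnd, hc⟩
  obtain ⟨d, rfl⟩ := List.length_eq_one_iff.1 h
  exact ⟨d, rfl⟩

end Subgroup

end QuarticMap

/-- A subgroup of a diagram none of whose strands returns to it can be turned. -/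
lemma Diagram.exists_turn [Finite V] (D : Diagram V) (r : D.Subgroup)
    (hout : ∀ k, (D.edge (r.strand k)).1 ∉ r.vertices) :
    ∃ (D' : Diagram V) (r' : D'.Subgroup), Reachable D D' ∧ r'.vertices = r.vertices ∧
      r'.size = r.size ∧ (∀ k, D'.edge (r'.strand k) = D.edge (r.strand (k + 1))) ∧
      AgreeOff r.vertices D.toQuarticMap D'.toQuarticMap := by
  have hne := hout 0
  obtain ⟨m, c, hc, rfl⟩ := r.exists_eq_ofTwist
  have hout' := hout
  simp only [Subgroup.strand_ofTwist, Subgroup.vertices_ofTwist] at hout'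
  have h := hc.isTurnOf_turnMap fun k i hi => hout' k ⟨i, hi.symm⟩
  have h3 := h.threeEdgeConnected D.prime
  have : Nontrivial V := ⟨((Subgroup.ofTwist hc).strand 0).1, (D.edge ((Subgroup.ofTwist hc).strand 0)).1,
    fun hi => hne (hi ▸ Subgroup.strand_mem _ 0)⟩
  let D' : Diagram V := ⟨D.turnMap c hc.injective, by
    rw [EulerPlanar, h.numFaces_eq]
    exact D.planar,
    h.alternating (fun i => by simp only [rot, even_add_one_zmod_four]) D.alternating,
    h3.not_isNugatoryAt, h3⟩
  let r' : D'.Subgroup := Subgroup.ofTwist h.twist'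
  have hv : r'.vertices = (Subgroup.ofTwist hc).vertices := by
    rw [Subgroup.vertices_ofTwist, Subgroup.vertices_ofTwist]
    rfl
  have hedge : ∀ k, D'.edge (r'.strand k) = D.edge ((Subgroup.ofTwist hc).strand (k + 1)) := by
    intro k
    rw [Subgroup.strand_ofTwist, Subgroup.strand_ofTwist]
    exact h.edge_tip k
  have hagree : AgreeOff (Subgroup.ofTwist hc).vertices D.toQuarticMap D'.toQuarticMap := by
    rw [Subgroup.vertices_ofTwist]
    exact h.agreeOff
  refine ⟨D', r', Relation.ReflTransGen.single (Or.inl ⟨Subgroup.ofTwist hc, r', hv, hout, hedge,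
    hagree⟩), hv, ?_, hedge, hagree⟩
  rw [Subgroup.size_ofTwist, Subgroup.size_ofTwist]

end

/-! ### Triangles of subgroups and the relation between their sizes -/

section

variable {V U ι : Type*}

lemma iUnion_fin_three {α : Type*} (f : Fin 3 → Set α) : (⋃ i, f i) = f 0 ∪ f 1 ∪ f 2 := by
  ext x
  simp only [Set.mem_iUnion, Set.mem_union]
  constructor
  · rintro ⟨i, hi⟩
    fin_cases i <;> tauto
  · rintro ((h | h) | h)
    exacts [⟨0, h⟩, ⟨1, h⟩, ⟨2, h⟩]

lemma forall_fin_three {p : Fin 3 → Prop} (h0 : p 0) (h1 : p 1) (h2 : p 2) : ∀ i, p i := by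
  intro i
  fin_cases i <;> assumption

lemma pairwise_disjoint_fin_three {α : Type*} {f : Fin 3 → Set α} (h0 : Disjoint (f 0) (f 1))
    (h1 : Disjoint (f 1) (f 2)) (h2 : Disjoint (f 0) (f 2)) :
    Pairwise fun i j => Disjoint (f i) (f j) := by
  intro i j hij
  fin_cases i <;> fin_cases j <;> first | exact absurd rfl hij | assumption | (symm; assumption)

/-- The three subgroups `X 0, X 1, X 2` form a triangle in `D`, in clockwise order; `S` is the set
of their vertices. The strands `o i, o i + 1` of `X i` point away from the triangle and lead
to `l i` and `r i`. -/
structure IsTri (D : Diagram V) (S : Set V) (X : Fin 3 → D.Subgroup) (o : Fin 3 → ZMod 4)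
    (l r : Fin 3 → Dart V) : Prop where
  disjoint : Pairwise fun i j => Disjoint (X i).vertices (X j).vertices
  vertices : (⋃ i, (X i).vertices) = S
  side : ∀ i, D.edge ((X i).strand (o i + 2)) = (X (i + 1)).strand (o (i + 1) + 3)
  left : ∀ i, D.edge ((X i).strand (o i)) = l i
  right : ∀ i, D.edge ((X i).strand (o i + 1)) = r i
  left_out : ∀ i, (l i).1 ∉ S
  right_out : ∀ i, (r i).1 ∉ S

namespace IsTri

variable {D : Diagram V} {S : Set V} {X : Fin 3 → D.Subgroup} {o : Fin 3 → ZMod 4}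
  {l r : Fin 3 → Dart V}

lemma subset (h : IsTri D S X o l r) (i : Fin 3) : (X i).vertices ⊆ S :=
  h.vertices ▸ Set.subset_iUnion (fun i => (X i).vertices) i

lemma side' (h : IsTri D S X o l r) (i : Fin 3) :
    D.edge ((X (i + 1)).strand (o (i + 1) + 3)) = (X i).strand (o i + 2) :=
  edge_eq_comm.1 (h.side i)

lemma shift (h : IsTri D S X o l r) : IsTri D S (fun i => X (i + 1)) (fun i => o (i + 1))
    (fun i => l (i + 1)) (fun i => r (i + 1)) where
  disjoint i j hij := h.disjoint (by simpa using hij)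
  vertices := by
    rw [← h.vertices]
    exact (Equiv.addRight (1 : Fin 3)).surjective.iUnion_comp (fun i => (X i).vertices)
  side i := h.side _
  left i := h.left _
  right i := h.right _
  left_out i := h.left_out _
  right_out i := h.right_out _

lemma edge_notMem (h : IsTri D S X o l r) (i : Fin 3) (k : ZMod 4) :
    (D.edge ((X i).strand k)).1 ∉ (X i).vertices := by
  obtain ⟨k, rfl⟩ : ∃ j, k = o i + j := ⟨k - o i, by ring⟩
  revert k
  refine forall_zmod_four ?_ ?_ ?_ ?_
  · rw [add_zero, h.left]
    exact fun hi => h.left_out i (h.subset i hi)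
  · rw [h.right]
    exact fun hi => h.right_out i (h.subset i hi)
  · rw [h.side]
    exact Set.disjoint_left.1 (h.disjoint (show i + 1 ≠ i by simp)) (Subgroup.strand_mem _ _)
  · obtain ⟨j, rfl⟩ := exists_eq_add_one i
    rw [h.side']
    exact Set.disjoint_left.1 (h.disjoint (show j ≠ j + 1 by simp)) (Subgroup.strand_mem _ _)

/-- A turn renumbers the strands of `X i` by one step, which the offset `o i` absorbs; the triangle
and the six strands around it stay as they are. -/
lemma turn [Finite V] (h : IsTri D S X o l r) (i : Fin 3) :
    ∃ (D' : Diagram V) (X' : Fin 3 → D'.Subgroup), Reachable D D' ∧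
      IsTri D' S X' (Function.update o i (o i - 1)) l r ∧ (∀ j, (X' j).size = (X j).size) ∧
      AgreeOff S D.toQuarticMap D'.toQuarticMap := by
  obtain ⟨D', r', hreach, hv, hs, hedge, hagree⟩ := D.exists_turn (X i) (h.edge_notMem i)
  have hdis : ∀ j, j ≠ i → Disjoint (X j).vertices (X i).vertices := fun j hj => h.disjoint hj
  obtain ⟨X', hX'i, hX'⟩ : ∃ X' : Fin 3 → D'.Subgroup, X' i = r' ∧
      ∀ j, j ≠ i → (X' j).darts = (X j).darts := by
    refine ⟨fun j => if hj : j = i then r' else (X j).transferOff hagree (hdis j hj), by simp, ?_⟩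
    intro j hj
    simp only [hj, dite_false]
    rfl
  have hX's : ∀ j, j ≠ i → ∀ k, (X' j).strand k = (X j).strand k := fun j hj k =>
    Subgroup.strand_congr (hX' j hj) k
  have hX'v : ∀ j, (X' j).vertices = (X j).vertices := fun j => by
    by_cases hj : j = i
    · subst hj; rw [hX'i, hv]
    · exact Subgroup.vertices_congr (hX' j hj)
  have hmem : ∀ j, j ≠ i → ∀ k, ((X j).strand k).1 ∉ (X i).vertices := fun j hj k =>
    Set.disjoint_left.1 (hdis j hj) (Subgroup.strand_mem _ _)
  have hkeep : ∀ j, j ≠ i → ∀ k, (D.edge ((X j).strand k)).1 ∉ (X i).vertices →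
      D'.edge ((X' j).strand k) = D.edge ((X j).strand k) := fun j hj k hk => by
    rw [hX's j hj]
    exact hagree _ (hmem j hj k) hk
  refine ⟨D', X', hreach, ⟨?_, ?_, ?_, ?_, ?_, h.left_out, h.right_out⟩, ?_,
    hagree.mono (h.subset i)⟩
  · simpa only [hX'v] using h.disjoint
  · simpa only [hX'v] using h.vertices
  · intro j
    by_cases hj : j = i
    · subst hj
      have hj1 : j + 1 ≠ j := by simp
      rw [hX'i, hedge, Function.update_self, Function.update_of_ne hj1, hX's _ hj1, ← h.side]
      congr 2
      ring
    · rw [Function.update_of_ne hj]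
      by_cases hj1 : j + 1 = i
      · subst hj1
        rw [Function.update_self, edge_eq_comm, hX'i, hedge, hX's j hj, ← h.side']
        congr 2
        ring
      · rw [Function.update_of_ne hj1, hkeep j hj, h.side, hX's _ hj1]
        rw [h.side]
        exact hmem _ hj1 _
  · intro j
    by_cases hj : j = i
    · subst hj
      rw [hX'i, hedge, Function.update_self, sub_add_cancel, h.left]
    · rw [Function.update_of_ne hj, hkeep j hj, h.left]
      rw [h.left]
      exact fun hl => h.left_out j (h.subset i hl)
  · intro j
    by_cases hj : j = i
    · subst hj
      rw [hX'i, hedge, Function.update_self, sub_add_cancel, h.right]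
    · rw [Function.update_of_ne hj, hkeep j hj, h.right]
      rw [h.right]
      exact fun hl => h.right_out j (h.subset i hl)
  · intro j
    by_cases hj : j = i
    · subst hj; rw [hX'i, hs]
    · exact Subgroup.size_congr (hX' j hj)

lemma turn_nat [Finite V] (h : IsTri D S X o l r) (i : Fin 3) (n : ℕ) :
    ∃ (D' : Diagram V) (X' : Fin 3 → D'.Subgroup), Reachable D D' ∧
      IsTri D' S X' (Function.update o i (o i - n)) l r ∧ (∀ j, (X' j).size = (X j).size) ∧
      AgreeOff S D.toQuarticMap D'.toQuarticMap := by
  induction n with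
  | zero => exact ⟨D, X, Relation.ReflTransGen.refl, by simpa using h, fun _ => rfl, .refl _ _⟩
  | succ n ih =>
    obtain ⟨D₁, X₁, hr₁, h₁, hs₁, ha₁⟩ := ih
    obtain ⟨D₂, X₂, hr₂, h₂, hs₂, ha₂⟩ := h₁.turn i
    refine ⟨D₂, X₂, hr₁.trans hr₂, ?_, fun j => (hs₂ j).trans (hs₁ j), ha₁.trans ha₂⟩
    convert h₂ using 1
    simp [sub_sub]

/-- All the subgroups of a triangle can be turned into the direction away from the triangle. -/
lemma turn_all [Finite V] (h : IsTri D S X o l r) :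
    ∃ (D' : Diagram V) (X' : Fin 3 → D'.Subgroup), Reachable D D' ∧
      IsTri D' S X' (fun _ => 0) l r ∧ (∀ j, (X' j).size = (X j).size) ∧
      AgreeOff S D.toQuarticMap D'.toQuarticMap := by
  obtain ⟨D₁, X₁, hr₁, h₁, hs₁, ha₁⟩ := h.turn_nat 0 (o 0).val
  obtain ⟨D₂, X₂, hr₂, h₂, hs₂, ha₂⟩ := h₁.turn_nat 1 (o 1).val
  obtain ⟨D₃, X₃, hr₃, h₃, hs₃, ha₃⟩ := h₂.turn_nat 2 (o 2).val
  refine ⟨D₃, X₃, (hr₁.trans hr₂).trans hr₃, ?_, fun j => ((hs₃ j).trans (hs₂ j)).trans (hs₁ j),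
    (ha₁.trans ha₂).trans ha₃⟩
  convert h₃ using 1
  funext i
  fin_cases i <;> simp [Function.update]

end IsTri

/-- Whenever three subgroups of sizes `x 0, x 1, x 2` form a triangle in a diagram, then operations
`T` and `OTS` transform them into three subgroups of sizes `y 0, y 1, y 2` in the `ots`-shifted
position, whose axes point away from the triangle. -/
def Moves (V : Type*) (x y : Fin 3 → ℕ) : Prop :=
  ∀ (D : Diagram V) (S : Set V) (X : Fin 3 → D.Subgroup) (o : Fin 3 → ZMod 4)
    (l r : Fin 3 → Dart V), IsTri D S X o l r → (∀ i, (X i).size = x i) →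
    ∃ (D' : Diagram V) (Y : Fin 3 → D'.Subgroup), Reachable D D' ∧
      IsTri D' S Y (fun _ => 0) r (fun i => l (i + 1)) ∧ (∀ i, (Y i).size = y i) ∧
      AgreeOff S D.toQuarticMap D'.toQuarticMap

namespace Moves

lemma shift {x y : Fin 3 → ℕ} (h : Moves V x y) :
    Moves V (fun i => x (i + 1)) (fun i => y (i + 1)) := by
  have h3 : ∀ i : Fin 3, i + 1 + 1 + 1 = i := by decide
  intro D S X o l r hX hs
  -- Two shifts undo one shift, because three shifts are the identity.
  obtain ⟨D', Y, hr, hY, hsY, ha⟩ := h D S _ _ _ _ hX.shift.shift fun i =>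
    (hs _).trans (congrArg x (h3 i))
  refine ⟨D', fun i => Y (i + 1), hr, ?_, fun i => hsY _, ha⟩
  have := hY.shift
  simp only [h3] at this
  exact this

lemma rotate {a b c a' b' c' : ℕ} (h : Moves V ![a, b, c] ![a', b', c']) :
    Moves V ![b, c, a] ![b', c', a'] := by
  convert h.shift using 1 <;> funext i <;> fin_cases i <;> rfl

/-- The operation OTS itself; everything else about sizes is derived from it by rotation and `comp`.
-/
lemma one [Finite V] : Moves V ![1, 1, 1] ![1, 1, 1] := by
  intro D S X o l r hX hs
  have hx : ∀ i, ∃ d, X i = Subgroup.single d := fun i =>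
    (X i).exists_eq_single (by rw [hs]; fin_cases i <;> rfl)
  choose x hx using hx
  obtain rfl : X = fun i => Subgroup.single (x i) := funext hx
  let t : Fin 3 → Dart V := fun i => rot (x i) (o i)
  have hmem : ∀ i, (t i).1 ∈ S := fun i =>
    hX.subset i (by rw [Subgroup.single_vertices]; rfl)
  have hleft : ∀ i, D.edge (t i) = l i := fun i => by
    have := hX.left i
    rwa [Subgroup.single_strand] at this
  have hright : ∀ i, D.edge (rot (t i) 1) = r i := fun i => by
    have := hX.right i
    rwa [Subgroup.single_strand, ← rot_rot] at this
  have ht : D.IsOtsTriangle t :=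
    { injective := by
        intro i j hij
        by_contra hne
        have := hX.disjoint hne
        simp only [Subgroup.single_vertices, Set.disjoint_singleton] at this
        exact this hij
      side := fun i => by
        have := hX.side i
        rwa [Subgroup.single_strand, Subgroup.single_strand, ← rot_rot, ← rot_rot] at this
      left_out := fun i j hij => hX.left_out i (by rw [← hleft, hij]; exact hmem j)
      right_out := fun i j hij => hX.right_out i (by rw [← hright, hij]; exact hmem j) }
  obtain ⟨D', hmove, hots⟩ := D.exists_otsMove ht
  have hS : (Set.range fun i => (t i).1) = S := by
    rw [← hX.vertices]
    ext v
    simp [Subgroup.single_vertices, t, eq_comm]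
  refine ⟨D', fun i => Subgroup.single (rot (t i) 1), Relation.ReflTransGen.single (Or.inr hmove),
    ⟨?_, ?_, fun i => ?_, fun i => ?_, fun i => ?_, hX.right_out, fun i => hX.left_out _⟩,
    fun i => by fin_cases i <;> rfl, ?_⟩
  · have := hX.disjoint
    simp only [Subgroup.single_vertices] at this ⊢
    exact this
  · have := hX.vertices
    simp only [Subgroup.single_vertices] at this ⊢
    exact this
  · rw [Subgroup.single_strand, Subgroup.single_strand, zero_add, zero_add]
    exact hots.side i
  · rw [Subgroup.single_strand, rot_zero, hots.left, hright]
  · rw [Subgroup.single_strand, zero_add, hots.right, hleft]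
  · rw [← hS]
    exact hots.agreeOff

/-- The first subgroup is cut into an outer piece P of size l and an inner piece Q of size k. Moving
the triangle of Q with the two neighbours produces subgroups of sizes u, p, v, and the two adjacent
to P form with it a second triangle, on the other side of their common edge. Moving that one too,
the subgroup opposite P is joined by a 2-gon to the one of size p, and the two are merged. -/
lemma comp [Finite V] {k l c b u p v w₀ w₁ w₂ : ℕ} (hl : 0 < l) (hk : 0 < k)
    (h₁ : Moves V ![k, c, b] ![u, p, v]) (h₂ : Moves V ![l, u, v] ![w₀, w₁, w₂]) :
    Moves V ![l + k, c, b] ![w₀, p + w₁, w₂] := by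
  intro D S X₀ o L R hX₀ hs₀
  -- The axis of the first subgroup has to point away from the triangle, so that a cut across it
  -- leaves an inner and an outer piece.
  obtain ⟨D₀, X, hr₀, hX, hs, ha₀⟩ := hX₀.turn_all
  replace hs : ∀ i, (X i).size = ![l + k, c, b] i := fun i => (hs i).trans (hs₀ i)
  obtain ⟨P, Q, hPQ, h3, h2, hX0, hsP, hsQ⟩ := (X 0).exists_split hl hk (hs 0)
  have hv0 : (X 0).vertices = P.vertices ∪ Q.vertices := by rw [hX0, Subgroup.append_vertices]
  have hS : S = P.vertices ∪ Q.vertices ∪ (X 1).vertices ∪ (X 2).vertices := by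
    rw [← hX.vertices, iUnion_fin_three, hv0]
  have hd01 := hX.disjoint (show (0 : Fin 3) ≠ 1 by decide)
  have hd02 := hX.disjoint (show (0 : Fin 3) ≠ 2 by decide)
  have hd12 := hX.disjoint (show (1 : Fin 3) ≠ 2 by decide)
  simp only at hd01 hd02 hd12
  rw [hv0, Set.disjoint_union_left] at hd01 hd02
  have hside := hX.side
  have hleft := hX.left
  have hright := hX.right
  simp only [zero_add] at hside hright
  have s0 := hside 0
  have s1 := hside 1
  have s2 := hside 2
  have l0 := hleft 0
  have r0 := hright 0
  simp only [zero_add, show (1 : Fin 3) + 1 = 2 from rfl, show (2 : Fin 3) + 1 = 0 from rfl]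
    at s0 s1 s2
  rw [hX0, Subgroup.append_strand_two] at s0
  rw [hX0, Subgroup.append_strand_three] at s2
  rw [hX0, Subgroup.append_strand_zero] at l0
  rw [hX0, Subgroup.append_strand_one] at r0
  -- the first triangle
  set S₁ : Set V := Q.vertices ∪ (X 1).vertices ∪ (X 2).vertices with hS₁
  have hPS₁ : Disjoint P.vertices S₁ := by
    simp only [hS₁, Set.disjoint_union_right]
    exact ⟨⟨hPQ, hd01.1⟩, hd02.1⟩
  have hS₁S : S₁ ⊆ S := by
    rw [hS, hS₁]
    intro v
    simp only [Set.mem_union]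
    tauto
  have hPS : P.vertices ⊆ S := by
    rw [hS]
    intro v
    simp only [Set.mem_union]
    tauto
  have hP : ∀ k, (P.strand k).1 ∉ S₁ := fun k =>
    Set.disjoint_left.1 hPS₁ (Subgroup.strand_mem _ _)
  have hT₁ : IsTri D₀ S₁ ![Q, X 1, X 2] (fun _ => 0) ![P.strand 3, L 1, L 2]
      ![P.strand 2, R 1, R 2] :=
    { disjoint := pairwise_disjoint_fin_three hd01.2 hd12 hd02.2
      vertices := iUnion_fin_three _
      side := forall_fin_three (by simpa using s0) s1 (by simpa using s2)
      left := forall_fin_three (edge_eq_comm.1 h3) (hleft 1) (hleft 2)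
      right := forall_fin_three (edge_eq_comm.1 h2) (hright 1) (hright 2)
      left_out := forall_fin_three (hP 3) (fun h => hX.left_out 1 (hS₁S h))
        (fun h => hX.left_out 2 (hS₁S h))
      right_out := forall_fin_three (hP 2) (fun h => hX.right_out 1 (hS₁S h))
        (fun h => hX.right_out 2 (hS₁S h)) }
  obtain ⟨D₁, Y, hr₁, hY, hsY, ha₁⟩ := h₁ D₀ S₁ _ _ _ _ hT₁
    (forall_fin_three hsQ (hs 1) (hs 2))
  have hYd01 := hY.disjoint (show (0 : Fin 3) ≠ 1 by decide)
  have hYd02 := hY.disjoint (show (0 : Fin 3) ≠ 2 by decide)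
  have hYd12 := hY.disjoint (show (1 : Fin 3) ≠ 2 by decide)
  simp only at hYd01 hYd02 hYd12
  have hYS : S₁ = (Y 0).vertices ∪ (Y 1).vertices ∪ (Y 2).vertices := by
    rw [← hY.vertices, iUnion_fin_three]
  have hYside := hY.side
  have hYleft := hY.left
  have hYright := hY.right
  simp only [zero_add] at hYside hYright
  have t0 : D₁.edge ((Y 0).strand 2) = (Y 1).strand 3 := hYside 0
  have t1 : D₁.edge ((Y 1).strand 2) = (Y 2).strand 3 := hYside 1
  have t2 : D₁.edge ((Y 2).strand 2) = (Y 0).strand 3 := hYside 2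
  have yl0 : D₁.edge ((Y 0).strand 0) = P.strand 2 := hYleft 0
  have yl1 : D₁.edge ((Y 1).strand 0) = R 1 := hYleft 1
  have yl2 : D₁.edge ((Y 2).strand 0) = R 2 := hYleft 2
  have yr0 : D₁.edge ((Y 0).strand 1) = L 1 := hYright 0
  have yr1 : D₁.edge ((Y 1).strand 1) = L 2 := hYright 1
  have yr2 : D₁.edge ((Y 2).strand 1) = P.strand 3 := hYright 2
  -- the second triangle
  let P' : D₁.Subgroup := P.transferOff ha₁ hPS₁
  have hPY : ∀ i, Disjoint P.vertices (Y i).vertices := fun i => hPS₁.mono_right (hY.subset i)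
  set S₂ : Set V := P.vertices ∪ (Y 0).vertices ∪ (Y 2).vertices with hS₂
  have hS₂S : S₂ ⊆ S := by
    rw [hS₂]
    exact Set.union_subset (Set.union_subset hPS ((hY.subset 0).trans hS₁S))
      ((hY.subset 2).trans hS₁S)
  have hY1S₂ : Disjoint (Y 1).vertices S₂ := by
    simp only [hS₂, Set.disjoint_union_right]
    exact ⟨⟨(hPY 1).symm, hYd01.symm⟩, hYd12⟩
  have hY1 : ∀ k, ((Y 1).strand k).1 ∉ S₂ := fun k =>
    Set.disjoint_left.1 hY1S₂ (Subgroup.strand_mem _ _)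
  have pl : D₁.edge (P.strand 0) = L 0 := by
    rw [ha₁ _ (hP 0) (by rw [l0]; exact fun h => hX.left_out 0 (hS₁S h)), l0]
  have pr : D₁.edge (P.strand 1) = R 0 := by
    rw [ha₁ _ (hP 1) (by rw [r0]; exact fun h => hX.right_out 0 (hS₁S h)), r0]
  -- The offsets 1 and 3 record that `Y 0` and `Y 2`, with axes pointing away from the first
  -- triangle, are seen sideways from the second one.
  have hT₂ : IsTri D₁ S₂ ![P', Y 0, Y 2] ![0, 1, 3] ![L 0, L 1, (Y 1).strand 2]
      ![R 0, (Y 1).strand 3, R 2] :=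
    { disjoint := pairwise_disjoint_fin_three (hPY 0) hYd02 (hPY 2)
      vertices := iUnion_fin_three _
      side := forall_fin_three (edge_eq_comm.1 yl0) (edge_eq_comm.1 t2) yr2
      left := forall_fin_three pl yr0 (edge_eq_comm.1 t1)
      right := forall_fin_three pr t0 yl2
      left_out := forall_fin_three (fun h => hX.left_out 0 (hS₂S h))
        (fun h => hX.left_out 1 (hS₂S h)) (hY1 2)
      right_out := forall_fin_three (fun h => hX.right_out 0 (hS₂S h)) (hY1 3)
        (fun h => hX.right_out 2 (hS₂S h)) }
  obtain ⟨D₂, W, hr₂, hW, hsW, ha₂⟩ := h₂ D₁ S₂ _ _ _ _ hT₂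
    (forall_fin_three hsP (hsY 0) (hsY 2))
  have hWS : S₂ = (W 0).vertices ∪ (W 1).vertices ∪ (W 2).vertices := by
    rw [← hW.vertices, iUnion_fin_three]
  have hWd01 := hW.disjoint (show (0 : Fin 3) ≠ 1 by decide)
  have hWd02 := hW.disjoint (show (0 : Fin 3) ≠ 2 by decide)
  have hWd12 := hW.disjoint (show (1 : Fin 3) ≠ 2 by decide)
  simp only at hWd01 hWd02 hWd12
  have hWside := hW.side
  have hWright := hW.right
  simp only [zero_add] at hWside hWright
  have hY1W : ∀ i, Disjoint (Y 1).vertices (W i).vertices := fun i =>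
    hY1S₂.mono_right (hW.subset i)
  let Y' : D₂.Subgroup := (Y 1).transferOff ha₂ hY1S₂
  -- Both inner strands of `Y 1` now lead to the outer end of `W 1`: this is the 2-gon at which the
  -- two are merged.
  have z3 : D₂.edge (Y'.strand 3) = (W 1).strand 0 := edge_eq_comm.1 (hW.left 1)
  have z2 : D₂.edge (Y'.strand 2) = (W 1).strand 1 := edge_eq_comm.1 (hWright 1)
  have hR1 : D₂.edge ((Y 1).strand 0) = R 1 := by
    rw [ha₂ _ (hY1 0) (by rw [yl1]; exact fun h => hX.right_out 1 (hS₂S h)), yl1]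
  have hL2 : D₂.edge ((Y 1).strand 1) = L 2 := by
    rw [ha₂ _ (hY1 1) (by rw [yr1]; exact fun h => hX.left_out 2 (hS₂S h)), yr1]
  have hZd : Disjoint Y'.vertices (W 1).vertices := hY1W 1
  obtain ⟨Z, hZv, hZs, hZ0, hZ1, hZ2, hZ3⟩ : ∃ Z : D₂.Subgroup,
      Z.vertices = (Y 1).vertices ∪ (W 1).vertices ∧ Z.size = (Y 1).size + (W 1).size ∧
      Z.strand 0 = (Y 1).strand 0 ∧ Z.strand 1 = (Y 1).strand 1 ∧
      Z.strand 2 = (W 1).strand 2 ∧ Z.strand 3 = (W 1).strand 3 :=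
    ⟨Subgroup.append Y' (W 1) hZd z3 z2, Subgroup.append_vertices hZd z3 z2,
      Subgroup.append_size hZd z3 z2, Subgroup.append_strand_zero hZd z3 z2,
      Subgroup.append_strand_one hZd z3 z2, Subgroup.append_strand_two hZd z3 z2,
      Subgroup.append_strand_three hZd z3 z2⟩
  have hZ0d : Disjoint (W 0).vertices Z.vertices := by
    rw [hZv, Set.disjoint_union_right]
    exact ⟨(hY1W 0).symm, hWd01⟩
  have hZ2d : Disjoint Z.vertices (W 2).vertices := by
    rw [hZv, Set.disjoint_union_left]
    exact ⟨hY1W 2, hWd12⟩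
  have hvert : (W 0).vertices ∪ Z.vertices ∪ (W 2).vertices = S := by
    have e1 : (W 0).vertices ∪ Z.vertices ∪ (W 2).vertices = (Y 1).vertices ∪ S₂ := by
      rw [hWS, hZv]
      ext v
      simp only [Set.mem_union]
      tauto
    have e2 : S = P.vertices ∪ S₁ := by
      rw [hS, hS₁]
      ext v
      simp only [Set.mem_union]
      tauto
    rw [e1, e2, hYS, hS₂]
    ext v
    simp only [Set.mem_union]
    tauto
  refine ⟨D₂, ![W 0, Z, W 2], (hr₀.trans hr₁).trans hr₂, ?_, ?_,
    (ha₀.trans (ha₁.mono hS₁S)).trans (ha₂.mono hS₂S)⟩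
  · exact
    { disjoint := pairwise_disjoint_fin_three hZ0d hZ2d hWd02
      vertices := (iUnion_fin_three _).trans hvert
      side := forall_fin_three ((hWside 0).trans hZ3.symm)
        ((congrArg D₂.edge hZ2).trans (hWside 1)) (hWside 2)
      left := forall_fin_three (hW.left 0) ((congrArg D₂.edge hZ0).trans hR1) (hW.left 2)
      right := forall_fin_three (hWright 0) ((congrArg D₂.edge hZ1).trans hL2) (hWright 2)
      left_out := hX.right_out
      right_out := fun i => hX.left_out _ }
  · exact forall_fin_three (hsW 0) (hZs.trans (congrArg₂ _ (hsY 1) (hsW 1))) (hsW 2)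

end Moves

end

/-! ### Parity arithmetic of the sizes -/

section

variable {V : Type*}

namespace Moves

/-- After the innermost crossing has passed by OTS, the neighbours are again single crossings, and
the next crossing can follow. -/
lemma push_one [Finite V] (n : ℕ) : Moves V ![n + 1, 1, 1] ![1, n + 1, 1] := by
  induction n with
  | zero => exact one
  | succ n ih =>
    have := comp (Nat.succ_pos n) one_pos one ih
    rwa [add_comm 1 (n + 1)] at this

/-- If a single crossing can pass between two subgroups, which thereby swap their positions, then
so can a subgroup of any size. -/
lemma iterate [Finite V] {b c : ℕ} (h : Moves V ![1, c, b] ![b, 1, c]) (h' : Moves V ![1, b, c] ![c, 1, b])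
    {n : ℕ} (hn : 0 < n) : (Odd n → Moves V ![n, c, b] ![b, n, c]) ∧
      (Even n → Moves V ![n, c, b] ![c, n, b]) := by
  suffices H : ∀ n, (Odd (n + 1) → Moves V ![n + 1, c, b] ![b, n + 1, c] ∧
      Moves V ![n + 1, b, c] ![c, n + 1, b]) ∧ (Even (n + 1) →
      Moves V ![n + 1, c, b] ![c, n + 1, b] ∧ Moves V ![n + 1, b, c] ![b, n + 1, c]) by
    obtain ⟨m, rfl⟩ : ∃ m, n = m + 1 := ⟨n - 1, by omega⟩
    exact ⟨fun hm => ((H m).1 hm).1, fun hm => ((H m).2 hm).1⟩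
  intro n
  induction n with
  | zero => exact ⟨fun _ => ⟨h, h'⟩, fun hn => absurd hn (by decide)⟩
  | succ n ih =>
    constructor
    · intro hn
      obtain ⟨h1, h2⟩ := ih.2 (Nat.not_odd_iff_even.1 (Nat.odd_add_one.1 hn))
      -- The innermost crossing passes first and swaps the neighbours, so the remaining crossings
      -- need the induction hypothesis with b and c interchanged.
      have e1 := comp (Nat.succ_pos n) one_pos h h2
      have e2 := comp (Nat.succ_pos n) one_pos h' h1
      rw [add_comm 1] at e1 e2
      exact ⟨e1, e2⟩
    · intro hn
      obtain ⟨h1, h2⟩ := ih.1 (Nat.not_even_iff_odd.1 (Nat.even_add_one.1 hn))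
      have e1 := comp (Nat.succ_pos n) one_pos h h2
      have e2 := comp (Nat.succ_pos n) one_pos h' h1
      rw [add_comm 1] at e1 e2
      exact ⟨e1, e2⟩

/-- `push_one` seen from its two neighbours: each of them is a single crossing that passes between
the other one and the subgroup of size m. These are the two inputs that `iterate` needs. -/
lemma single_one [Finite V] {m : ℕ} (hm : 0 < m) :
    Moves V ![1, 1, m] ![m, 1, 1] ∧ Moves V ![1, m, 1] ![1, 1, m] := by
  obtain ⟨n, rfl⟩ : ∃ n, m = n + 1 := ⟨m - 1, by omega⟩
  exact ⟨(push_one n).rotate, (push_one n).rotate.rotate⟩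

lemma push_odd [Finite V] {n m : ℕ} (hn : Odd n) (hm : 0 < m) :
    Moves V ![n, 1, m] ![m, n, 1] ∧ Moves V ![n, m, 1] ![1, n, m] :=
  ⟨(iterate (single_one hm).1 (single_one hm).2 hn.pos).1 hn,
    (iterate (single_one hm).2 (single_one hm).1 hn.pos).1 hn⟩

lemma push_even [Finite V] {n m : ℕ} (hn : Even n) (hn0 : 0 < n) (hm : 0 < m) :
    Moves V ![n, 1, m] ![1, n, m] ∧ Moves V ![n, m, 1] ![m, n, 1] :=
  ⟨(iterate (single_one hm).1 (single_one hm).2 hn0).2 hn,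
    (iterate (single_one hm).2 (single_one hm).1 hn0).2 hn⟩

/-- The oddness of b and c is what makes a single crossing pass with a swap: `push_odd` moves b,
respectively c, crossings through, and after a rotation it is the single crossing that passes. Then
`iterate` applies with a crossings. -/
lemma of_odd_odd [Finite V] {a b c : ℕ} (ha : 0 < a) (hb : Odd b) (hc : Odd c) :
    (Odd a → Moves V ![a, c, b] ![b, a, c]) ∧ (Even a → Moves V ![a, c, b] ![c, a, b]) :=
  iterate (push_odd hb hc.pos).1.rotate (push_odd hc hb.pos).1.rotate ha

/-- Since b is even, the rotated `push_even` gives (1,c,b) → (b,c,1): the subgroup of size c stands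
opposite A, with a single crossing in the remaining place. The other a - 1 crossings pass between b
and this single crossing, swap them since a - 1 is odd, and are added to c. -/
lemma of_even_even_right [Finite V] {a b c : ℕ} (ha0 : 0 < a) (hb0 : 0 < b) (hc : 0 < c) (ha : Even a)
    (hb : Even b) : Moves V ![a, c, b] ![1, a + c - 1, b] := by
  obtain ⟨n, rfl⟩ : ∃ n, a = n + 1 := ⟨a - 1, by omega⟩
  have hn : Odd n := Nat.not_even_iff_odd.1 (Nat.even_add_one.1 ha)
  have := comp (V := V) hn.pos one_pos (push_even hb hb0 hc).1.rotate (push_odd hn hb0).2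
  rwa [show c + n = n + 1 + c - 1 by omega] at this

/-- The mirror argument, starting with (1,c,b) → (1,b,c), where c is even; here b is the size that
grows by a - 1. -/
lemma of_even_even_left [Finite V] {a b c : ℕ} (ha0 : 0 < a) (hb0 : 0 < b) (hc0 : 0 < c) (ha : Even a)
    (hc : Even c) : Moves V ![a, c, b] ![c, a + b - 1, 1] := by
  obtain ⟨n, rfl⟩ : ∃ n, a = n + 1 := ⟨a - 1, by omega⟩
  have hn : Odd n := Nat.not_even_iff_odd.1 (Nat.even_add_one.1 ha)
  have := comp (V := V) hn.pos one_pos (push_even hc hc0 hb0).2.rotate.rotate (push_odd hn hc0).1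
  rwa [show b + n = n + 1 + b - 1 by omega] at this

lemma exists_rotate {a b c : ℕ} (h : ∃ y, Moves V ![a, b, c] y) : ∃ y, Moves V ![b, c, a] y := by
  obtain ⟨y, hy⟩ := h
  refine ⟨fun i => y (i + 1), ?_⟩
  convert hy.shift using 1
  funext i
  fin_cases i <;> rfl

/-- Among three parities two agree. Two odd sizes, or two even ones, can be rotated into the
position that one of the previous lemmas requires. -/
lemma exists_of_pos [Finite V] {a b c : ℕ} (ha : 0 < a) (hb : 0 < b) (hc : 0 < c) :
    ∃ y, Moves V ![a, c, b] y := by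
  have key : ∀ {a b c : ℕ}, 0 < a → Odd b → Odd c → ∃ y, Moves V ![a, c, b] y := by
    intro a b c ha hb hc
    rcases Nat.even_or_odd a with h | h
    · exact ⟨_, (of_odd_odd ha hb hc).2 h⟩
    · exact ⟨_, (of_odd_odd ha hb hc).1 h⟩
  rcases Nat.even_or_odd a with ha' | ha' <;> rcases Nat.even_or_odd b with hb' | hb' <;>
    rcases Nat.even_or_odd c with hc' | hc'
  · exact ⟨_, of_even_even_right ha hb hc ha' hb'⟩
  · exact ⟨_, of_even_even_right ha hb hc ha' hb'⟩
  · exact ⟨_, of_even_even_left ha hb hc ha' hc'⟩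
  · exact key ha hb' hc'
  · exact exists_rotate (exists_rotate ⟨_, of_even_even_left hc ha hb hc' hb'⟩)
  · exact exists_rotate (key hb hc' ha')
  · exact exists_rotate (exists_rotate (key hc ha' hb'))
  · exact key ha hb' hc'

end Moves

end

/-! ### Collapses, 2-gons and condensations -/

section

variable {V U : Type*}

namespace QuarticMap.Subgroup

variable {M : QuarticMap V} (r : M.Subgroup)

lemma tip_eq_rot {m : ℕ} (c : Fin (m + 1) → Dart V) (k : ZMod 4) :
    ∃ i, tip c k = rot (c i) k := by
  unfold tip
  split_ifs
  exacts [⟨_, rfl⟩, ⟨_, rfl⟩]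

/-- The strand k is a half-edge of the list rotated by k, so the rotation at a crossing tells which
strand it is. -/
lemma eq_add_of_strand_eq_rot {k k' j : ZMod 4} (h : r.strand k' = rot (r.strand k) j) :
    k' = k + j := by
  obtain ⟨m, c, hc, rfl⟩ := r.exists_eq_ofTwist
  rw [strand_ofTwist, strand_ofTwist] at h
  obtain ⟨i, hi⟩ := tip_eq_rot c k
  obtain ⟨i', hi'⟩ := tip_eq_rot c k'
  rw [hi, hi', rot_rot] at h
  exact (hc.rot_inj h).2

lemma strand_injective : Function.Injective r.strand := fun k k' h => by
  have := r.eq_add_of_strand_eq_rot (k := k) (k' := k') (j := 0) (by rw [rot_zero, h])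
  rw [this, add_zero]

/-- A half-edge that leaves the subgroup is one of its strands. -/
lemma exists_strand_eq {d : Dart V} (h1 : d.1 ∈ r.vertices) (h2 : (M.edge d).1 ∉ r.vertices) :
    ∃ k, d = r.strand k := by
  obtain ⟨m, c, hc, rfl⟩ := r.exists_eq_ofTwist
  rw [vertices_ofTwist] at h1 h2
  simp only [strand_ofTwist]
  obtain ⟨i, hi⟩ := h1
  obtain ⟨k, rfl⟩ := exists_eq_rot hi.symm
  revert h2
  refine rot_cases c (p := fun d => (M.edge d).1 ∉ (Set.range fun i => (c i).1) →
    ∃ k, d = tip c k) (fun k _ => ⟨k, rfl⟩) ?_ ?_ ?_ ?_ i k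
  · intro i h
    rw [hc.edge_zero] at h
    exact absurd ⟨_, rfl⟩ h
  · intro i h
    rw [hc.edge_one] at h
    exact absurd ⟨_, rfl⟩ h
  · intro i h
    rw [hc.edge_two] at h
    exact absurd ⟨_, rfl⟩ h
  · intro i h
    rw [hc.edge_three] at h
    exact absurd ⟨_, rfl⟩ h

/-- The strands `k` and `k + 1` are at the same end of the subgroup. -/
lemma strand_add_one_eq_iff (k : ZMod 4) :
    r.strand (k + 1) = rot (r.strand k) 1 ↔ r.size = 1 ∨ Even k := by
  obtain ⟨m, c, hc, rfl⟩ := r.exists_eq_ofTwist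
  rw [strand_ofTwist, strand_ofTwist, size_ofTwist]
  have e0 : Even (0 : ZMod 4) := by unfold Even; decide
  have e1 : ¬ Even (1 : ZMod 4) := by unfold Even; decide
  have e2 : Even (2 : ZMod 4) := by unfold Even; decide
  have e3 : ¬ Even (3 : ZMod 4) := by unfold Even; decide
  have hm : Fin.last m = 0 ↔ m + 1 = 1 := by simp [Fin.ext_iff]
  revert k
  refine forall_zmod_four ?_ ?_ ?_ ?_
  · simp
  · rw [show (1 : ZMod 4) + 1 = 2 by decide, tip_two, tip_one, rot_rot,
      show (1 : ZMod 4) + 1 = 2 by decide, ← hm]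
    simp only [e1, or_false]
    exact ⟨fun h => (hc.rot_inj h).1, fun h => by rw [h]⟩
  · rw [show (2 : ZMod 4) + 1 = 3 by decide, tip_three, tip_two, rot_rot,
      show (2 : ZMod 4) + 1 = 3 by decide]
    simp only [e2, or_true]
  · rw [show (3 : ZMod 4) + 1 = 0 by decide, tip_zero, tip_three, rot_rot,
      show (3 : ZMod 4) + 1 = 0 by decide, rot_zero, ← hm]
    simp only [e3, or_false]
    exact ⟨fun h => hc.injective (congrArg Prod.fst h.symm), fun h => by rw [h]⟩

/-- A single crossing can be read with any direction of the axis, a longer subgroup in two opposite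
ones. This brings the end at a 2-gon into the position required by `append`. -/
lemma exists_strand_zero_eq {k : ZMod 4} (h : r.size = 1 ∨ Even k) : ∃ r' : M.Subgroup,
    r'.vertices = r.vertices ∧ r'.strand 0 = r.strand k ∧ r'.strand 1 = r.strand (k + 1) := by
  rcases h with h | h
  · obtain ⟨d, rfl⟩ := r.exists_eq_single h
    refine ⟨single (rot d k), ?_, ?_, ?_⟩
    · rw [single_vertices, single_vertices]
      rfl
    · rw [single_strand, single_strand, rot_zero]
    · rw [single_strand, single_strand, rot_rot]
  · obtain rfl | rfl : k = 0 ∨ k = 2 := by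
      revert h
      unfold Even
      revert k
      decide
    · exact ⟨r, rfl, rfl, by rw [zero_add]⟩
    · obtain ⟨r', h1, -, h2⟩ := r.exists_reverse
      exact ⟨r', h1, by rw [h2, zero_add], by rw [h2, add_comm]⟩

lemma exists_strand_two_eq {k : ZMod 4} (h : r.size = 1 ∨ Even k) : ∃ r' : M.Subgroup,
    r'.vertices = r.vertices ∧ r'.strand 2 = r.strand k ∧ r'.strand 3 = r.strand (k + 1) := by
  obtain ⟨r₁, h1, h2, h3⟩ := r.exists_strand_zero_eq h
  obtain ⟨r₂, h4, -, h5⟩ := r₁.exists_reverse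
  refine ⟨r₂, h4.trans h1, ?_, ?_⟩
  · rw [h5, show (2 : ZMod 4) + 2 = 0 by decide, h2]
  · rw [h5, show (3 : ZMod 4) + 2 = 1 by decide, h3]

end QuarticMap.Subgroup

namespace QuarticMap

/-- The half-edges `g, rot g 1` of one vertex and `h, rot h 1` of another vertex bound a 2-gon. -/
structure IsBigon (G : QuarticMap U) (g h : Dart U) : Prop where
  left : G.edge g = rot h 1
  right : G.edge (rot g 1) = h
  ne : g.1 ≠ h.1

lemma IsBigon.symm {G : QuarticMap U} {g h : Dart U} (H : G.IsBigon g h) : G.IsBigon h g :=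
  ⟨edge_eq_comm.1 H.right, edge_eq_comm.1 H.left, H.ne.symm⟩

end QuarticMap

namespace Collapse

variable {M : QuarticMap V} {G : QuarticMap U} (κ : Collapse M G)

lemma edge_strand (d : Dart U) : M.edge (κ.strand d) = κ.strand (G.edge d) := κ.compat d

lemma strand_mem (d : Dart U) : (κ.strand d).1 ∈ (κ.part d.1).vertices :=
  Subgroup.strand_mem _ _

lemma eq_of_mem {v : V} {u w : U} (hu : v ∈ (κ.part u).vertices)
    (hw : v ∈ (κ.part w).vertices) : u = w := (κ.cover v).unique hu hw

lemma disjoint {u w : U} (h : u ≠ w) : Disjoint (κ.part u).vertices (κ.part w).vertices :=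
  Set.disjoint_left.2 fun _ hu hw => h (κ.eq_of_mem hu hw)

lemma strand_injective : Function.Injective κ.strand := by
  rintro ⟨u, a⟩ ⟨w, b⟩ h
  have h1 := κ.strand_mem (u, a)
  rw [h] at h1
  obtain rfl := κ.eq_of_mem h1 (κ.strand_mem (w, b))
  have := (κ.part u).strand_injective h
  simpa using this

/-- The half-edges that `g` and `rot g 1` stand for are at the same crossing. -/
lemma strand_rot_one_eq_iff (g : Dart U) : κ.strand (rot g 1) = rot (κ.strand g) 1 ↔
    (κ.part g.1).size = 1 ∨ Even (g.2 + κ.offset g.1) := by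
  rw [← Subgroup.strand_add_one_eq_iff]
  simp only [strand, rot]
  rw [add_right_comm]

/-- The 2-gon of `G` comes from a 2-gon of `M`. -/
structure IsBadBigon (g h : Dart U) : Prop where
  bigon : G.IsBigon g h
  left : (κ.part g.1).size = 1 ∨ Even (g.2 + κ.offset g.1)
  right : (κ.part h.1).size = 1 ∨ Even (h.2 + κ.offset h.1)

variable {κ}

lemma IsBadBigon.symm {g h : Dart U} (H : κ.IsBadBigon g h) : κ.IsBadBigon h g :=
  ⟨H.bigon.symm, H.right, H.left⟩

lemma exists_strand_eq {d : Dart V} {u : U} (h1 : d.1 ∈ (κ.part u).vertices)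
    (h2 : (M.edge d).1 ∉ (κ.part u).vertices) : ∃ g : Dart U, g.1 = u ∧ d = κ.strand g := by
  obtain ⟨k, hk⟩ := (κ.part u).exists_strand_eq h1 h2
  exact ⟨(u, k - κ.offset u), rfl, by simp [strand, hk]⟩

lemma eq_rot_one {g g' : Dart U} (h : κ.strand g' = rot (κ.strand g) 1) : g' = rot g 1 := by
  have hu : g'.1 = g.1 := by
    have h1 := κ.strand_mem g'
    rw [h] at h1
    exact κ.eq_of_mem h1 (κ.strand_mem g)
  obtain ⟨k, rfl⟩ := exists_eq_rot hu
  have h' : (κ.part g.1).strand (g.2 + k + κ.offset g.1) =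
      rot ((κ.part g.1).strand (g.2 + κ.offset g.1)) 1 := h
  have hk : k = 1 := by linear_combination (κ.part g.1).eq_add_of_strand_eq_rot h'
  rw [hk]

/-- A strictly larger subgroup somewhere passes from one part of the collapse to another, and the
2-gon at which it does so is a bad one. -/
lemma isCondensation_of_forall (h : ∀ g g', ¬ κ.IsBadBigon g g') : κ.IsCondensation := by
  intro u r' hr'
  by_contra hne
  obtain ⟨v, hv, hvu⟩ := Set.not_subset.1 hne
  obtain ⟨m, c, hc, rfl⟩ := r'.exists_eq_ofTwist
  rw [Subgroup.vertices_ofTwist] at hr' hv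
  obtain ⟨i, hi⟩ := hr' (Subgroup.strand_mem (κ.part u) 0)
  obtain ⟨i', hi'⟩ := hv
  obtain ⟨j, hj⟩ := exists_change (fun i => (c i).1 ∈ (κ.part u).vertices)
    ⟨i, by simp only at hi; rw [hi]; exact Subgroup.strand_mem _ _⟩
    ⟨i', by simp only at hi'; rwa [hi']⟩
  obtain ⟨w, hw, -⟩ := κ.cover (c j.castSucc).1
  obtain ⟨w', hw', -⟩ := κ.cover (c j.succ).1
  have hww : w ≠ w' := by
    rintro rfl
    by_cases hwu : w = u
    · subst hwu; tauto
    · exact hj ⟨fun h => absurd (κ.eq_of_mem hw h) hwu, fun h => absurd (κ.eq_of_mem hw' h) hwu⟩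
  have h1 : (c j.castSucc).1 ∉ (κ.part w').vertices := fun h => hww (κ.eq_of_mem hw h)
  have h2 : (c j.succ).1 ∉ (κ.part w).vertices := fun h => hww (κ.eq_of_mem h hw')
  obtain ⟨g, hg, hgs⟩ := κ.exists_strand_eq (d := rot (c j.castSucc) 2) hw
    (by rw [hc.edge_two]; exact h2)
  obtain ⟨g₁, -, hgs₁⟩ := κ.exists_strand_eq (d := rot (c j.castSucc) 3) hw
    (by rw [hc.edge_three]; exact h2)
  obtain ⟨k, hk, hks⟩ := κ.exists_strand_eq (d := c j.succ) hw'
    (by rw [hc.edge_zero]; exact h1)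
  obtain ⟨k₁, -, hks₁⟩ := κ.exists_strand_eq (d := rot (c j.succ) 1) hw'
    (by rw [hc.edge_one]; exact h1)
  have hgg : κ.strand g₁ = rot (κ.strand g) 1 := by
    rw [← hgs, ← hgs₁, rot_rot, show (2 : ZMod 4) + 1 = 3 by decide]
  have hkk : κ.strand k₁ = rot (κ.strand k) 1 := by rw [← hks, ← hks₁]
  obtain rfl := κ.eq_rot_one hgg
  obtain rfl := κ.eq_rot_one hkk
  refine h g k ⟨⟨?_, ?_, by rwa [hg, hk]⟩, (κ.strand_rot_one_eq_iff g).1 hgg,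
    (κ.strand_rot_one_eq_iff k).1 hkk⟩
  · apply κ.strand_injective
    rw [← edge_strand, ← hgs, ← hks₁, hc.edge_two]
  · apply κ.strand_injective
    rw [← edge_strand, ← hgs₁, ← hks, hc.edge_three]

/-- At a bad 2-gon the two parts could be joined end to end to a longer subgroup, against
maximality. -/
lemma IsCondensation.not_isBadBigon (hκ : κ.IsCondensation) (g h : Dart U) :
    ¬ κ.IsBadBigon g h := by
  rintro ⟨hb, hl, hr⟩
  obtain ⟨r₁, hv₁, h12, h13⟩ := (κ.part g.1).exists_strand_two_eq hl
  obtain ⟨r₂, hv₂, h20, h21⟩ := (κ.part h.1).exists_strand_zero_eq hr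
  have hd : Disjoint r₁.vertices r₂.vertices := by
    rw [hv₁, hv₂]
    exact κ.disjoint hb.ne
  have e3 : M.edge (r₁.strand 3) = r₂.strand 0 := by
    rw [h13, h20]
    have := κ.edge_strand (rot g 1)
    rw [hb.right] at this
    simp only [strand, rot] at this
    rwa [add_right_comm] at this
  have e2 : M.edge (r₁.strand 2) = r₂.strand 1 := by
    rw [h12, h21]
    have := κ.edge_strand g
    rw [hb.left] at this
    simp only [strand, rot] at this
    rwa [add_right_comm h.2] at this
  have := hκ g.1 (Subgroup.append r₁ r₂ hd e3 e2) (by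
    rw [Subgroup.append_vertices, hv₁]
    exact Set.subset_union_left)
  rw [Subgroup.append_vertices, hv₂] at this
  exact hb.ne (κ.eq_of_mem (this (Or.inr (κ.strand_mem h))) (κ.strand_mem h))

/-- In the condensation of a diagram there are no loops. -/
lemma edge_fst_ne {D : Diagram V} {κ : Collapse D.toQuarticMap G} {u w : U} (huw : u ≠ w)
    (k : ZMod 4) : (G.edge (u, k)).1 ≠ u := by
  intro hk
  obtain ⟨k', hk'⟩ : ∃ k', G.edge (u, k) = (u, k') := ⟨_, Prod.ext hk rfl⟩
  have hkk : k ≠ k' := by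
    rintro rfl
    exact G.edge_ne _ hk'
  have hkk' : k + κ.offset u ≠ k' + κ.offset u := fun h => hkk (add_right_cancel h)
  -- A loop would use up two of the four strands of the part, and the other two would form a cut
  -- that is too small.
  obtain ⟨a, b, hab⟩ : ∃ a b : ZMod 4, ∀ j, j ≠ k + κ.offset u → j ≠ k' + κ.offset u →
      j = a ∨ j = b := by
    generalize k + κ.offset u = x at hkk' ⊢
    generalize k' + κ.offset u = y at hkk' ⊢
    revert x y
    decide
  refine D.prime.not_cut_subset (S := (κ.part u).vertices)
    ⟨_, Subgroup.strand_mem _ 0⟩ ⟨_, fun h =>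
      huw (κ.eq_of_mem h (Subgroup.strand_mem (κ.part w) 0))⟩
    ((κ.part u).strand a) ((κ.part u).strand b) ?_
  rintro d ⟨hd1, hd2⟩
  obtain ⟨j, rfl⟩ := (κ.part u).exists_strand_eq hd1 hd2
  have h1 : j ≠ k + κ.offset u := by
    rintro rfl
    have := κ.edge_strand (u, k)
    rw [hk'] at this
    refine hd2 ?_
    change (D.edge (κ.strand (u, k))).1 ∈ _
    rw [this]
    exact κ.strand_mem (u, k')
  have h2 : j ≠ k' + κ.offset u := by
    rintro rfl
    have := κ.edge_strand (u, k')
    rw [← hk', G.edge_edge] at this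
    refine hd2 ?_
    change (D.edge (κ.strand (u, k'))).1 ∈ _
    rw [← hk', this]
    exact κ.strand_mem (u, k)
  rcases hab j h1 h2 with rfl | rfl <;> simp

/-- Turning one part leaves the collapsed graph unchanged and shifts the offset at its node by one.
For a part of size at least 2 this interchanges the pairs of strands that share an end with those
that do not. -/
lemma exists_turn [Finite V] {D : Diagram V} (κ : Collapse D.toQuarticMap G) {u : U}
    (hu : ∀ k, (G.edge (u, k)).1 ≠ u) :
    ∃ (D' : Diagram V) (κ' : Collapse D'.toQuarticMap G), Reachable D D' ∧
      (∀ w, (κ'.part w).size = (κ.part w).size) ∧ (∀ w, w ≠ u → κ'.offset w = κ.offset w) ∧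
      κ'.offset u = κ.offset u - 1 := by
  classical
  have hE : ∀ k, ∃ g : Dart U, g.1 ≠ u ∧ D.edge ((κ.part u).strand k) = κ.strand g := by
    intro k
    refine ⟨G.edge (u, k - κ.offset u), hu _, ?_⟩
    rw [← edge_strand]
    simp [strand]
  obtain ⟨D', r', hreach, hv, hs, hedge, hagree⟩ := D.exists_turn (κ.part u) fun k hk => by
    obtain ⟨g, hg, hgk⟩ := hE k
    rw [hgk] at hk
    exact hg (κ.eq_of_mem (κ.strand_mem g) hk)
  obtain ⟨X, hXu, hX⟩ : ∃ X : U → D'.Subgroup, X u = r' ∧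
      ∀ w, w ≠ u → (X w).darts = (κ.part w).darts := by
    refine ⟨fun w => if hw : w = u then r' else (κ.part w).transferOff hagree (κ.disjoint hw),
      by simp, ?_⟩
    intro w hw
    simp only [hw, dite_false]
    rfl
  have hXv : ∀ w, (X w).vertices = (κ.part w).vertices := fun w => by
    by_cases hw : w = u
    · subst hw; rw [hXu, hv]
    · exact Subgroup.vertices_congr (hX w hw)
  let off : U → ZMod 4 := Function.update κ.offset u (κ.offset u - 1)
  have hoffu : off u = κ.offset u - 1 := Function.update_self ..
  have hoff : ∀ w, w ≠ u → off w = κ.offset w := fun w hw => Function.update_of_ne hw ..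
  have hst : ∀ d : Dart U, d.1 ≠ u → (X d.1).strand (d.2 + off d.1) = κ.strand d := fun d hd => by
    rw [Subgroup.strand_congr (hX d.1 hd), hoff _ hd]
    rfl
  have hcu : ∀ d : Dart U, d.1 = u → D'.edge ((X d.1).strand (d.2 + off d.1)) =
      (X (G.edge d).1).strand ((G.edge d).2 + off (G.edge d).1) := by
    rintro ⟨w, k⟩ rfl
    rw [hst _ (hu k)]
    simp only
    rw [hXu, hedge, hoffu, show k + (κ.offset w - 1) + 1 = k + κ.offset w by ring]
    exact κ.edge_strand (w, k)
  refine ⟨D', ⟨X, off, ?_, ?_⟩, hreach, ?_, hoff, hoffu⟩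
  · simpa only [hXv] using κ.cover
  · intro d
    by_cases hd : d.1 = u
    · exact hcu d hd
    · by_cases hd' : (G.edge d).1 = u
      · have := hcu _ hd'
        rw [G.edge_edge] at this
        exact edge_eq_comm.1 this
      · rw [hst d hd, hst _ hd', ← edge_strand]
        refine hagree _ (fun h => hd (κ.eq_of_mem (κ.strand_mem d) h)) fun h => hd' ?_
        rw [edge_strand] at h
        exact κ.eq_of_mem (κ.strand_mem _) h
  · intro w
    by_cases hw : w = u
    · subst hw; exact (congrArg Subgroup.size hXu).trans hs
    · exact Subgroup.size_congr (hX w hw)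

lemma exists_turn_finset [Finite V] {D : Diagram V} (κ : Collapse D.toQuarticMap G)
    (F : Finset U) (hF : ∀ u ∈ F, ∀ k, (G.edge (u, k)).1 ≠ u) :
    ∃ (D' : Diagram V) (κ' : Collapse D'.toQuarticMap G), Reachable D D' ∧
      (∀ w, (κ'.part w).size = (κ.part w).size) ∧ (∀ w, w ∉ F → κ'.offset w = κ.offset w) ∧
      ∀ w ∈ F, κ'.offset w = κ.offset w - 1 := by
  classical
  induction F using Finset.induction_on with
  | empty => exact ⟨D, κ, Relation.ReflTransGen.refl, fun _ => rfl, fun _ _ => rfl, by simp⟩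
  | insert u F hu ih =>
    obtain ⟨D₁, κ₁, hr₁, hs₁, ho₁, hF₁⟩ := ih fun w hw => hF w (Finset.mem_insert_of_mem hw)
    obtain ⟨D₂, κ₂, hr₂, hs₂, ho₂, hu₂⟩ := κ₁.exists_turn (hF u (Finset.mem_insert_self _ _))
    refine ⟨D₂, κ₂, hr₁.trans hr₂, fun w => (hs₂ w).trans (hs₁ w), fun w hw => ?_,
      fun w hw => ?_⟩
    · rw [Finset.mem_insert, not_or] at hw
      rw [ho₂ w hw.1, ho₁ w hw.2]
    · by_cases hwu : w = u
      · subst hwu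
        rw [hu₂, ho₁ w hu]
      · rw [ho₂ w hwu, hF₁ w (Finset.mem_of_mem_insert_of_ne hw hwu)]

end Collapse

end

/-! ### From moves of sizes to realized triples -/

section

variable {V U : Type*}

/-- A 2-gon at a vertex of an `ots`-triangle is bounded by the outgoing strands of this vertex. -/
lemma QuarticMap.IsOtsTriangle.eq_of_isBigon {G : QuarticMap U} {s : Fin 3 → Dart U}
    (hs : G.IsOtsTriangle s) {g h : Dart U} (hb : G.IsBigon g h) {i : Fin 3}
    (hi : g.1 = (s i).1) : g = s i := by
  obtain ⟨k, rfl⟩ := exists_eq_rot hi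
  have hv : (G.edge (rot (s i) k)).1 = (G.edge (rot (s i) (k + 1))).1 := by
    rw [hb.left, ← rot_rot, hb.right]
    rfl
  clear hb hi
  obtain ⟨j, rfl⟩ := exists_eq_add_one i
  revert k
  refine forall_zmod_four ?_ ?_ ?_ ?_
  · intro; rw [rot_zero]
  · intro hv
    rw [show (1 : ZMod 4) + 1 = 2 by decide, hs.side] at hv
    exact absurd hv (hs.right_out _ _)
  · intro hv
    rw [show (2 : ZMod 4) + 1 = 3 by decide, hs.side, hs.side'] at hv
    exact absurd (hs.injective hv) ((by decide : ∀ j : Fin 3, j + 1 + 1 ≠ j) j)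
  · intro hv
    rw [show (3 : ZMod 4) + 1 = 0 by decide, hs.side', rot_zero] at hv
    exact absurd hv.symm (hs.left_out _ _)

/-- Turning the three groups of a triangle of the condensation and moving them to the
`ots`-shifted position gives all that is wanted. -/
lemma Moves.realizes [Finite V] {D : Diagram V} {G : QuarticMap U}
    {κ : Collapse D.toQuarticMap G} (hκ : κ.IsCondensation) {t : Fin 3 → Dart U}
    (ht : G.IsOtsTriangle t) {y : Fin 3 → ℕ}
    (h : Moves V (fun i => (κ.part (t i).1).size) y) : Realizes κ t y := by
  classical
  set S : Set V := ⋃ i, (κ.part (t i).1).vertices with hS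
  have hmemS : ∀ {v : V} {u : U}, v ∈ (κ.part u).vertices → (∀ i, u ≠ (t i).1) → v ∉ S := by
    intro v u hv hu hvS
    obtain ⟨i, hi⟩ := Set.mem_iUnion.1 hvS
    exact hu i (κ.eq_of_mem hv hi)
  have hst : ∀ i k, κ.strand (rot (t i) k) =
      (κ.part (t i).1).strand ((t i).2 + κ.offset (t i).1 + k) := fun i k => by
    simp only [Collapse.strand, rot]
    rw [add_right_comm]
  have hst0 : ∀ i, κ.strand (t i) =
      (κ.part (t i).1).strand ((t i).2 + κ.offset (t i).1) := fun i => rfl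
  have htri : IsTri D S (fun i => κ.part (t i).1) (fun i => (t i).2 + κ.offset (t i).1)
      (fun i => D.edge (κ.strand (t i))) (fun i => D.edge (κ.strand (rot (t i) 1))) :=
    { disjoint := fun i j hij => κ.disjoint (ht.injective.ne hij)
      vertices := rfl
      side := fun i => by
        rw [← hst, ← hst, κ.edge_strand, ht.side]
      left := fun i => rfl
      right := fun i => by rw [hst]
      left_out := fun i => by
        rw [κ.edge_strand]
        exact hmemS (κ.strand_mem _) (ht.left_out i)
      right_out := fun i => by
        rw [κ.edge_strand]
        exact hmemS (κ.strand_mem _) (ht.right_out i) }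
  obtain ⟨D', Y, hreach, hY, hsY, hagree⟩ := h D S _ _ _ _ htri fun _ => rfl
  -- the new graph and the new decomposition
  let G' : QuarticMap U := G.otsMap t ht.injective
  let s : Fin 3 → Dart U := fun i => rot (t i) 1
  have hots : G.IsOts t G' s := ht.isOts_otsMap
  have hs : G'.IsOtsTriangle s := hots.isOtsTriangle ht
  -- The value `Y 0` in the last branch is a dummy: the groups at nodes off the triangle are
  -- disjoint from S.
  obtain ⟨X, hXt, hX⟩ : ∃ X : U → D'.Subgroup, (∀ i, X (t i).1 = Y i) ∧
      ∀ u, (∀ i, u ≠ (t i).1) → (X u).darts = (κ.part u).darts := by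
    refine ⟨Function.extend (fun i => (t i).1) Y fun u =>
      if hu : Disjoint (κ.part u).vertices S then (κ.part u).transferOff hagree hu else Y 0,
      fun i => ht.injective.extend_apply _ _ i, fun u hu => ?_⟩
    have hdis : Disjoint (κ.part u).vertices S := Set.disjoint_left.2 fun v hv => hmemS hv hu
    rw [Function.extend_apply' _ _ _ (by rintro ⟨i, hi⟩; exact hu i hi.symm), dif_pos hdis]
    rfl
  -- With this offset the half-edge `s i` of G' stands for strand 0 of `Y i`.
  obtain ⟨off, hofft, hoff⟩ : ∃ off : U → ZMod 4, (∀ i, off (t i).1 = -(s i).2) ∧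
      ∀ u, (∀ i, u ≠ (t i).1) → off u = κ.offset u :=
    ⟨Function.extend (fun i => (t i).1) (fun i => -(s i).2) κ.offset,
      fun i => ht.injective.extend_apply _ _ i, fun u hu =>
        Function.extend_apply' _ _ _ (by rintro ⟨i, hi⟩; exact hu i hi.symm)⟩
  let str : Dart U → Dart V := fun g => (X g.1).strand (g.2 + off g.1)
  have hstr_in : ∀ i k, str (rot (s i) k) = (Y i).strand k := fun i k => by
    change (X (t i).1).strand ((s i).2 + k + off (t i).1) = _
    rw [hXt, hofft]
    congr 1
    ring
  have hstr_out : ∀ g : Dart U, (∀ i, g.1 ≠ (t i).1) → str g = κ.strand g := fun g hg => by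
    change (X g.1).strand (g.2 + off g.1) = _
    rw [Subgroup.strand_congr (hX _ hg), hoff _ hg]
    rfl
  have hYS : ∀ i, (Y i).vertices ⊆ S := hY.subset
  have hcover : ∀ v, ∃! u, v ∈ (X u).vertices := by
    intro v
    by_cases hv : v ∈ S
    · have hv' := hv
      rw [← hY.vertices] at hv'
      obtain ⟨i, hi⟩ := Set.mem_iUnion.1 hv'
      refine ⟨(t i).1, by simp only [hXt]; exact hi, fun u hu => ?_⟩
      by_cases hut : ∀ j, u ≠ (t j).1
      · simp only at hu
        rw [Subgroup.vertices_congr (hX u hut)] at hu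
        exact absurd hv (hmemS hu hut)
      · push Not at hut
        obtain ⟨j, rfl⟩ := hut
        simp only [hXt] at hu
        by_cases hji : j = i
        · rw [hji]
        · exact absurd hi (Set.disjoint_left.1 (hY.disjoint hji) hu)
    · obtain ⟨u, hu, -⟩ := κ.cover v
      have hut : ∀ i, u ≠ (t i).1 := by
        rintro i rfl
        exact hv (Set.mem_iUnion.2 ⟨i, hu⟩)
      refine ⟨u, by simp only; rwa [Subgroup.vertices_congr (hX u hut)], fun w hw => ?_⟩
      by_cases hwt : ∀ j, w ≠ (t j).1
      · simp only at hw
        rw [Subgroup.vertices_congr (hX w hwt)] at hw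
        exact κ.eq_of_mem hw hu
      · push Not at hwt
        obtain ⟨j, rfl⟩ := hwt
        simp only [hXt] at hw
        exact absurd (hYS j hw) hv
  have hY2 : ∀ i, D'.edge ((Y i).strand 2) = (Y (i + 1)).strand 3 := fun i => by
    simpa using hY.side i
  have hY0 : ∀ i, D'.edge ((Y i).strand 0) = D.edge (κ.strand (rot (t i) 1)) := hY.left
  have hY1 : ∀ i, D'.edge ((Y i).strand 1) = D.edge (κ.strand (t (i + 1))) := fun i => by
    simpa using hY.right i
  have hin : ∀ i k, D'.edge (str (rot (s i) k)) = str (G'.edge (rot (s i) k)) := by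
    intro i
    refine forall_zmod_four ?_ ?_ ?_ ?_
    · rw [hstr_in, hY0, rot_zero, hots.left, hstr_out _ (ht.right_out i), κ.edge_strand]
    · rw [hstr_in, hY1, hots.right, hstr_out _ (ht.left_out _), κ.edge_strand]
    · rw [hstr_in, hY2, hots.side, hstr_in]
    · obtain ⟨j, rfl⟩ := exists_eq_add_one i
      rw [hstr_in, hs.side', hstr_in]
      exact edge_eq_comm.1 (hY2 j)
  have hedge_out : ∀ g : Dart U, (∀ i, g.1 ≠ (t i).1) → (∀ i, (G'.edge g).1 ≠ (t i).1) →
      G'.edge g = G.edge g := fun g hg hg' =>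
    ((hots.symm ht).outside g (hots.ne.2 hg) (hots.ne.2 hg')).symm
  have hcompat : ∀ g, D'.edge (str g) = str (G'.edge g) := by
    intro g
    by_cases hg : ∀ i, g.1 ≠ (t i).1
    · by_cases hg' : ∀ i, (G'.edge g).1 ≠ (t i).1
      · rw [hstr_out g hg, hstr_out _ hg', hedge_out g hg hg', ← κ.edge_strand]
        refine hagree _ (hmemS (κ.strand_mem g) hg) ?_
        rw [κ.edge_strand, ← hedge_out g hg hg']
        exact hmemS (κ.strand_mem _) hg'
      · push Not at hg'
        obtain ⟨i, hi⟩ := hg'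
        obtain ⟨k, hk⟩ := exists_eq_rot (show (G'.edge g).1 = (s i).1 from hi)
        have := hin i k
        rw [← hk, G'.edge_edge] at this
        exact edge_eq_comm.1 this
    · push Not at hg
      obtain ⟨i, hi⟩ := hg
      obtain ⟨k, rfl⟩ := exists_eq_rot (show g.1 = (s i).1 from hi)
      exact hin i k
  let κ' : Collapse D'.toQuarticMap G' := ⟨X, off, hcover, hcompat⟩
  have hsize : ∀ u, (∀ i, u ≠ (t i).1) → (κ'.part u).size = (κ.part u).size := fun u hu =>
    Subgroup.size_congr (hX u hu)
  -- 2-gons of `D'` between different subgroups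
  have hbad : ∀ g g', κ'.IsBadBigon g g' → (∃ i, g = s i) ∨ ∃ i, g' = s i := by
    intro g g' hb
    by_cases hg : ∀ i, g.1 ≠ (t i).1
    · by_cases hg' : ∀ i, g'.1 ≠ (t i).1
      · refine absurd (⟨⟨?_, ?_, hb.bigon.ne⟩, ?_, ?_⟩ : κ.IsBadBigon g g')
          (hκ.not_isBadBigon g g')
        · rw [← hb.bigon.left, hedge_out g hg (by rw [hb.bigon.left]; exact hg')]
        · rw [← hb.bigon.right, hedge_out (rot g 1) hg (by rw [hb.bigon.right]; exact hg')]
        · rw [← hsize _ hg, ← hoff _ hg]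
          exact hb.left
        · rw [← hsize _ hg', ← hoff _ hg']
          exact hb.right
      · push Not at hg'
        obtain ⟨i, hi⟩ := hg'
        exact Or.inr ⟨i, hs.eq_of_isBigon hb.bigon.symm hi⟩
    · push Not at hg
      obtain ⟨i, hi⟩ := hg
      exact Or.inl ⟨i, hs.eq_of_isBigon hb.bigon hi⟩
  refine ⟨D', Y, G', s, κ', hreach,
    ⟨hY.disjoint, hY.vertices, hY2, hY0, hY1, fun d h1 h2 => ?_⟩, hsY, hots, hXt, hX, ?_, ?_⟩
  · refine hagree d (fun hd => ?_) fun hd => ?_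
    · obtain ⟨i, hi⟩ := Set.mem_iUnion.1 hd
      exact h1 i hi
    · obtain ⟨i, hi⟩ := Set.mem_iUnion.1 hd
      exact h2 i hi
  · intro hne
    -- The other side of such a 2-gon is an unchanged group of D, so the two outer strands of `Y i`
    -- would lead to the same crossing of D.
    have key : ∀ i g', ¬ κ'.IsBadBigon (s i) g' := by
      intro i g' hb
      have hl := hb.bigon.left
      have hr := hb.bigon.right
      rw [hots.left] at hl
      rw [hots.right] at hr
      have hg' : ∀ j, g'.1 ≠ (t j).1 := fun j => by
        rw [← hr]
        exact ht.left_out _ j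
      have hE := hb.right
      change (X g'.1).size = 1 ∨ Even (g'.2 + off g'.1) at hE
      rw [Subgroup.size_congr (hX _ hg'), hoff _ hg', ← κ.strand_rot_one_eq_iff] at hE
      refine hne i ?_
      rw [κ.edge_strand, κ.edge_strand, hl, hr, hE]
      rfl
    refine κ'.isCondensation_of_forall fun g g' hb => ?_
    rcases hbad g g' hb with ⟨i, rfl⟩ | ⟨i, rfl⟩
    · exact key i _ hb
    · exact key i _ hb.symm
  · intro hsz
    let other : Fin 3 → U := fun i => (G'.edge (rot (s i) 1)).1
    -- For each bad 2-gon at `s i` one of its two subgroups is turned, namely one with at least two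
    -- crossings. Passing to the image F ensures that a group that faces several of the `Y i` is
    -- turned only once.
    let node : Fin 3 → U := fun i => if 2 ≤ y i then (t i).1 else other i
    let I : Finset (Fin 3) := Finset.univ.filter fun i => ∃ g', κ'.IsBadBigon (s i) g'
    let F : Finset U := I.image node
    have hloop : ∀ u k, (G'.edge (u, k)).1 ≠ u := fun u k => by
      obtain ⟨i, hi⟩ : ∃ i, u ≠ (t i).1 := by
        by_contra hall
        push Not at hall
        exact absurd (ht.injective ((hall 0).symm.trans (hall 1))) (by decide)
      exact Collapse.edge_fst_ne (κ := κ') hi k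
    obtain ⟨D'', κ'', hreach', hs'', ho'', hF''⟩ := κ'.exists_turn_finset F fun u _ => hloop u
    refine ⟨D'', κ'', hreach.trans hreach', κ''.isCondensation_of_forall ?_⟩
    have heven : ∀ a b : ZMod 4, Even (a + (b - 1)) ↔ ¬ Even (a + b) := fun a b => by
      rw [show a + (b - 1) = a + b + 3 by
        rw [show (3 : ZMod 4) = -1 by decide]; ring, even_add_three_zmod_four]
    -- No turned node has a bad 2-gon: neither the old one nor a new one created by the turn.
    have hnotF : ∀ g g', κ''.IsBadBigon g g' → g.1 ∉ F := by
      intro g g' hb hgF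
      have hE := hb.left
      rw [hs'', hF'' _ hgF, heven] at hE
      obtain ⟨i, hi, hig⟩ := Finset.mem_image.1 hgF
      obtain ⟨g₁, hb₁⟩ := (Finset.mem_filter.1 hi).2
      have hl := hb₁.bigon.left
      have hr := hb₁.bigon.right
      have hother : other i = g₁.1 := congrArg Prod.fst hr
      by_cases hyi : 2 ≤ y i
      · have hg : g.1 = (s i).1 := by
          rw [← hig]
          exact if_pos hyi
        have hgs := hs.eq_of_isBigon hb.bigon hg
        subst hgs
        change (X (t i).1).size = 1 ∨ ¬ Even ((s i).2 + off (t i).1) at hE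
        rw [hXt, hsY, hofft, add_neg_cancel] at hE
        rcases hE with hE | hE
        · omega
        · exact hE Even.zero
      · have hg : g.1 = g₁.1 := by
          rw [← hig, ← hother]
          exact if_neg hyi
        have hg₁ : ∀ j, g₁.1 ≠ (t j).1 := fun j => by
          rw [← hr, hots.right]
          exact ht.left_out _ j
        have hsz' : 2 ≤ (κ.part g₁.1).size := by
          have e1 : G.edge (rot (t i) 1) = rot g₁ 1 := by rw [← hots.left, hl]
          have e2 : G.edge (t (i + 1)) = g₁ := by rw [← hots.right, hr]
          have := hsz i (by rw [e1, e2]; rfl)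
          rw [e2] at this
          exact this.resolve_left hyi
        have hE₁ := hb₁.right
        rw [hsize _ hg₁] at hE₁
        rw [hg, hsize _ hg₁] at hE
        replace hE := hE.resolve_left (by omega)
        replace hE₁ := hE₁.resolve_left (by omega)
        obtain ⟨k, rfl⟩ := exists_eq_rot hg
        -- After the turn, the ends of this group carry the pairs starting with `rot g₁ 1` and `rot
        -- g₁ 3`. Each pair contains one of the two strands that lead to `Y i`, so a 2-gon there
        -- would be bounded by `s i` on its other side; but then the strands would be matched the
        -- wrong way round.
        have hk : k = 1 ∨ k = 3 := by
          have hodd : ¬ Even k := fun hk => hE (by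
            have := hE₁.add hk
            rwa [add_right_comm] at this)
          clear hb hgF hE hig hg
          revert hodd
          unfold Even
          revert k
          decide
        have hinv : G'.edge (rot g₁ 1) = s i := edge_eq_comm.1 hl
        have hinv' : G'.edge g₁ = rot (s i) 1 := edge_eq_comm.1 hr
        rcases hk with rfl | rfl
        · have h1 := hb.bigon.left
          rw [hinv] at h1
          have h2 : g' = s i := hs.eq_of_isBigon hb.bigon.symm (congrArg Prod.fst h1).symm
          rw [h2] at h1
          have : rot (s i) 0 = rot (s i) 1 := by rw [rot_zero]; exact h1
          exact absurd (rot_inj.1 this) (by decide)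
        · have h1 := hb.bigon.right
          rw [rot_rot, show (3 : ZMod 4) + 1 = 0 by decide, rot_zero, hinv'] at h1
          have h2 : g' = s i := hs.eq_of_isBigon hb.bigon.symm (congrArg Prod.fst h1).symm
          rw [h2] at h1
          have : rot (s i) 0 = rot (s i) 1 := by rw [rot_zero]; exact h1.symm
          exact absurd (rot_inj.1 this) (by decide)
    have key : ∀ i g', κ''.IsBadBigon (s i) g' → κ'.IsBadBigon (s i) g' → False := by
      intro i g' hb hb'
      have hiI : node i ∈ F := Finset.mem_image_of_mem _ (Finset.mem_filter.2
        ⟨Finset.mem_univ _, g', hb'⟩)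
      by_cases hyi : 2 ≤ y i
      · have : node i = (s i).1 := if_pos hyi
        rw [this] at hiI
        exact hnotF _ _ hb hiI
      · have : node i = g'.1 := (if_neg hyi).trans (congrArg Prod.fst hb'.bigon.right)
        rw [this] at hiI
        exact hnotF _ _ hb.symm hiI
    intro g g' hb
    -- Neither side of a remaining bad 2-gon was turned, so it was bad before. It then lies at some
    -- `s i`, where one of its sides was turned after all.
    have hb' : κ'.IsBadBigon g g' := by
      refine ⟨hb.bigon, ?_, ?_⟩
      · rw [← hs'', ← ho'' _ (hnotF _ _ hb)]
        exact hb.left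
      · rw [← hs'', ← ho'' _ (hnotF _ _ hb.symm)]
        exact hb.right
    rcases hbad g g' hb' with ⟨i, rfl⟩ | ⟨i, rfl⟩
    · exact key i _ hb hb'
    · exact key i _ hb.symm hb'.symm

end

end AlternatingDiagrams

/-! ### The main theorem -/

open AlternatingDiagrams
theorem mainTheorem2 {V U : Type*} [Finite V] (D : Diagram V) (G : QuarticMap U)
    (κ : Collapse D.toQuarticMap G) (hκ : κ.IsCondensation)
    (t : Fin 3 → Dart U) (ht : G.IsOtsTriangle t) :
    (∃ m, Realizes κ t m) ∧
    ∀ a b c : ℕ, (κ.part (t 0).1).size = a → (κ.part (t 1).1).size = c →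
      (κ.part (t 2).1).size = b →
      (Odd b → Odd c → Even a → Realizes κ t ![c, a, b]) ∧
      (Odd b → Odd c → Odd a → Realizes κ t ![b, a, c]) ∧
      (Odd b → Even a → Even c → Realizes κ t ![c, a + b - 1, 1]) ∧
      (Even b → Even a → Realizes κ t ![1, a + c - 1, b]) := by
  have key : ∀ a b c : ℕ, (κ.part (t 0).1).size = a → (κ.part (t 1).1).size = c →
      (κ.part (t 2).1).size = b → 0 < a ∧ 0 < b ∧ 0 < c ∧
      ∀ y, Moves V ![a, c, b] y → Realizes κ t y := by
    rintro a b c rfl rfl rfl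
    refine ⟨QuarticMap.Subgroup.size_pos _, QuarticMap.Subgroup.size_pos _,
      QuarticMap.Subgroup.size_pos _, fun y hy => Moves.realizes hκ ht ?_⟩
    convert hy using 1
    funext i
    fin_cases i <;> rfl
  constructor
  · obtain ⟨ha, hb, hc, h⟩ := key _ _ _ rfl rfl rfl
    obtain ⟨y, hy⟩ := Moves.exists_of_pos (V := V) ha hb hc
    exact ⟨y, h y hy⟩
  · intro a b c h0 h1 h2
    obtain ⟨ha, hb, hc, h⟩ := key a b c h0 h1 h2
    exact ⟨fun ob oc ea => h _ ((Moves.of_odd_odd ha ob oc).2 ea),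
      fun ob oc oa => h _ ((Moves.of_odd_odd ha ob oc).1 oa),
      fun _ ea ec => h _ (Moves.of_even_even_left ha hb hc ea ec),
      fun eb ea => h _ (Moves.of_even_even_right ha hb hc ea eb)⟩
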